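/- **Model.** An *ability distribution* $F$ is a probability distribution on $(0,\infty)$ with a density $f$ that is continuous and positive on an open interval $I\subseteq(0,\infty)$ and zero outside $I$. Its quantile function is $v(q)=F^{-1}(1-q)$, $0<q<1$. There are $n\ge 2$ registered contestants with independent abilities $x_1,\dots,x_n\sim F$. In the *$m$-contestant winner-take-all contest* ($2\le m\le n$) with prize $B>0$, the $m$ contestants of highest ability are shortlisted; they learn that they are shortlisted and choose efforts $e_i\ge 0$ at cost $k e_i/x_i$ ($k>0$); the highest effort among them wins $B$ (ties are broken uniformly at random). The others exert no effort. For an effort function $b$, let $U_b(e\mid x)$ be the expected utility (expected prize minus cost) of a shortlisted contestant of ability $x$ who exerts effort $e$ while all other shortlisted contestants use $b$; the expectation is conditional on her ability $x$ and on her being shortlisted. A non-decreasing function $b:\mathbb R\to[0,\infty)$ is a *symmetric Bayesian Nash equilibrium* (sBNE) if for all $x\in I$, $e=b(x)$ maximizes $U_b(e\mid x)$ over $e\ge 0$. It is a *first-order sBNE* if $b(x)\to 0$ as $x\downarrow\inf I$ and, for all $x\in I$, $e\mapsto U_b(e\mid x)$ is differentiable at $e=b(x)$ with derivative $0$. Let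 $$\mathrm{ME}_{m,n}(b)=\mathbb E\Big[\max_{i\text{ shortlisted}} b(x_i)\Big]$$ be the expected maximum individual effort when the shortlisted contestants use $b$. **Theorem.** Let $0<L'\le L$. There are constants $c,C>0$, depending only on $L'$ and $L$, such that the following holds for every ability distribution $F$ with $L'\le|v'(q)|\le L$ for all $q\in(0,1)$, all $k,B>0$ and all $n\ge2$. The $n$-contestant winner-take-all contest has an sBNE, and the $2$-contestant winner-take-all contest has a first-order sBNE. For every sBNE $b_n$ of the $n$-contestant winner-take-all contest, and every $b_2$ that is an sBNE or a first-order sBNE of the $2$-contestant winner-take-all contest, $\mathrm{ME}_{n,n}(b_n)>0$ and $$c\,\log n\;\le\;\frac{\mathrm{ME}_{2,n}(b_2)}{\mathrm{ME}_{n,n}(b_n)}\;\le\;C\,\log n .$$ In particular the ratio is $\Theta(\log n)$. -/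

import Mathlib

open Set Filter Topology MeasureTheory ProbabilityTheory

noncomputable section

/-- A distribution of abilities: it has a density which is continuous and positive on an open
interval of positive reals and vanishes outside this interval. -/
structure AbilityDistribution where
  density : ℝ → ℝ
  density_nonneg : ∀ x, 0 ≤ density x
  isOpen_pos : IsOpen {x | 0 < density x}
  ordConnected_pos : OrdConnected {x | 0 < density x}
  pos_of_density_pos : ∀ x, 0 < density x → 0 < x
  continuousOn_density : ContinuousOn density {x | 0 < density x}
  integral_density : ∫ x, density x = 1

namespace AbilityDistribution

/-- The open interval of possible abilities. -/
def types (D : AbilityDistribution) : Set ℝ := {x | 0 < D.density x}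

/-- The law of the ability of one contestant. -/
def law (D : AbilityDistribution) : Measure ℝ :=
  volume.withDensity fun x => ENNReal.ofReal (D.density x)

/-- The distribution function `F`. -/
def cdf (D : AbilityDistribution) (x : ℝ) : ℝ := D.law.real (Iic x)

/-- The quantile function `v(q) = F⁻¹(1 - q)`, for `0 < q < 1`. -/
def quantile (D : AbilityDistribution) (q : ℝ) : ℝ := sInf {x | 1 - q ≤ D.cdf x}

/-- The joint law of the abilities of `n` registered contestants (independent, identically
distributed). -/
def profileLaw (D : AbilityDistribution) (n : ℕ) : Measure (Fin n → ℝ) :=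
  Measure.pi fun _ => D.law

end AbilityDistribution

/-- The shortlist: the contestants whose ability ranks among the top `m`. -/
def shortlist {n : ℕ} (m : ℕ) (y : Fin n → ℝ) : Finset (Fin n) :=
  Finset.univ.filter fun i => (Finset.univ.filter fun j => y i < y j).card < m

/-- The number of other shortlisted contestants whose effort is larger than the effort `e` of
contestant `i`, when they use the effort function `b`. -/
def numAbove {n : ℕ} (m : ℕ) (b : ℝ → ℝ) (i : Fin n) (e : ℝ) (y : Fin n → ℝ) : ℕ :=
  (((shortlist m y).erase i).filter fun j => e < b (y j)).card

/-- The number of other shortlisted contestants whose effort equals the effort `e` of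
contestant `i`, when they use the effort function `b`. -/
def numTied {n : ℕ} (m : ℕ) (b : ℝ → ℝ) (i : Fin n) (e : ℝ) (y : Fin n → ℝ) : ℕ :=
  (((shortlist m y).erase i).filter fun j => b (y j) = e).card

/-- The probability that contestant `i` gets rank `r` (ranks start at `1`) with effort `e` when
the abilities are `y`; ties are broken uniformly at random. -/
def rankShare {n : ℕ} (m : ℕ) (b : ℝ → ℝ) (i : Fin n) (e : ℝ) (y : Fin n → ℝ) (r : ℕ) : ℝ :=
  if numAbove m b i e y < r ∧ r ≤ numAbove m b i e y + numTied m b i e y + 1 then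
    1 / ((numTied m b i e y : ℝ) + 1)
  else 0

/-- The posterior law of the ability profile for contestant `i` of ability `x` who learns that she
is shortlisted. Her own coordinate is immaterial: it is always overwritten by `x`. -/
def posterior (D : AbilityDistribution) (n m : ℕ) (i : Fin n) (x : ℝ) : Measure (Fin n → ℝ) :=
  ProbabilityTheory.cond (D.profileLaw n) {y | i ∈ shortlist m (Function.update y i x)}

/-- The probability, in the eyes of the shortlisted contestant `i` of ability `x`, that she gets
rank `r` with effort `e` when all others use the effort function `b`. -/
def rankProb (D : AbilityDistribution) (n m : ℕ) (b : ℝ → ℝ) (i : Fin n) (x e : ℝ) (r : ℕ) : ℝ :=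
  ∫ y, rankShare m b i e (Function.update y i x) r ∂(posterior D n m i x)

/-- Expected utility: expected prize minus the cost `g e / x`. -/
def expectedUtility (D : AbilityDistribution) (n m : ℕ) (V : ℕ → ℝ) (g : ℝ → ℝ) (b : ℝ → ℝ)
    (i : Fin n) (x e : ℝ) : ℝ :=
  ∑ r ∈ Finset.Icc 1 m, V r * rankProb D n m b i x e r - g e / x

/-- Symmetric Bayesian Nash equilibrium: a monotone effort function such that for each shortlisted
contestant it is optimal to follow it if all others do. -/
structure IsSBNE (D : AbilityDistribution) (n m : ℕ) (V : ℕ → ℝ) (g : ℝ → ℝ) (b : ℝ → ℝ) :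
    Prop where
  monotone : Monotone b
  nonneg : ∀ x, 0 ≤ b x
  optimal : ∀ (i : Fin n), ∀ x ∈ D.types, ∀ e, 0 ≤ e →
    expectedUtility D n m V g b i x e ≤ expectedUtility D n m V g b i x (b x)

/-- The first-order version of `IsSBNE`: following the effort function is a critical point of the
expected utility as a function of the effort, and effort vanishes at the lowest abilities. -/
structure IsFirstOrderSBNE (D : AbilityDistribution) (n m : ℕ) (V : ℕ → ℝ) (g : ℝ → ℝ)
    (b : ℝ → ℝ) : Prop where
  monotone : Monotone b
  nonneg : ∀ x, 0 ≤ b x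
  tendsto_bottom : Tendsto b (𝓝[>] (sInf D.types)) (𝓝 0)
  critical : ∀ (i : Fin n), ∀ x ∈ D.types,
    HasDerivAt (fun e => expectedUtility D n m V g b i x e) 0 (b x)

/-- The expected maximum individual effort when shortlisted contestants use the effort function
`b` and the others exert no effort. -/
def maxEffort (D : AbilityDistribution) (n m : ℕ) (b : ℝ → ℝ) : ℝ :=
  ∫ y, (⨆ i : Fin n, if i ∈ shortlist m y then b (y i) else 0) ∂(D.profileLaw n)

/-- The whole budget `B` goes to the first rank. -/
def winnerTakeAll (B : ℝ) (r : ℕ) : ℝ := if r = 1 then B else 0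

/-- The linear cost function with slope `k`. -/
def linearCost (k : ℝ) (e : ℝ) : ℝ := k * e

end

/-! In equilibrium the marginal cost `k / x` of effort balances the marginal gain in the probability
of winning, so effort is a Stieltjes integral: `db = (B / k) x dΦ(x)`. When all `n` compete, being
shortlisted carries no news and `Φ = F ^ (n - 1)`, of total mass `1`. When only the top two compete,
the posterior of a contestant of ability `x` says that at most one rival is above her. The density
at `x` of the strongest rival is then `rivalRate n (F x) * f x`, with `rivalRate n u = (n - 1) / ((n
- 1) (1 - u) + u)` on `[0, 1]`. Hence `Φ = rivalPotential n ∘ F`, whose total mass is of order `log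
n`. This is the source of the logarithm.

The bounds on `v'` make the support bounded by a constant `R` times the median `x`
(`le_mul_median`), so the factor `x` in `db` matters only up to constants. If `Φ ≤ M`, then `b ≤ (B
/ k) R x M`. Conversely, with constant probability the best ability exceeds the quantile `y` at
level `1 - 1 / (4 n)`, where the effort is at least `(B / k) x (Φ y - Φ x)`. Both `Φ` gain a fixed
fraction of their mass, up to constants, between the median and `y`. So both expected maxima are
determined up to constants (`HasBidIncrements.maxEffort_bounds`).

Necessity of the formula for `db` rests on strict monotonicity (a flat piece would create ties that
are worth breaking). The winning probability at effort `b z` is then `oddsBelow` at `z`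
(`rankProb_apply`), and incentive constraints in both directions squeeze the increments of `b`. For
existence, `bidIntegral` defines the candidate without assuming that `Φ` is differentiable. -/

namespace AbilityDistribution

/-! ### Distribution function, quantiles and the bounded support. -/

variable (D : AbilityDistribution)

theorem integrable_density : Integrable D.density := by
  by_contra h
  have := D.integral_density
  rw [integral_undef h] at this
  exact zero_ne_one this

instance isProbabilityMeasure_law : IsProbabilityMeasure D.law := by
  refine ⟨?_⟩
  rw [law, withDensity_apply _ MeasurableSet.univ, Measure.restrict_univ,
    ← ofReal_integral_eq_lintegral_ofReal D.integrable_density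
      (Eventually.of_forall D.density_nonneg), D.integral_density, ENNReal.ofReal_one]

instance nullSingletonClass_law : NullSingletonClass D.law := by
  unfold law; infer_instance

instance isProbabilityMeasure_profileLaw (n : ℕ) : IsProbabilityMeasure (D.profileLaw n) := by
  unfold profileLaw; infer_instance

theorem isOpen_types : IsOpen D.types := D.isOpen_pos

theorem ordConnected_types : OrdConnected D.types := D.ordConnected_pos

theorem pos_of_mem_types {x : ℝ} (hx : x ∈ D.types) : 0 < x := D.pos_of_density_pos x hx

theorem law_compl_types : D.law D.typesᶜ = 0 := by
  rw [law, withDensity_apply _ D.isOpen_types.measurableSet.compl]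
  rw [setLIntegral_congr_fun (g := fun _ => 0) D.isOpen_types.measurableSet.compl]
  · simp
  · intro x hx
    simp only [types, mem_compl_iff, mem_ofPred_eq, not_lt] at hx
    simpa using hx

theorem types_nonempty : D.types.Nonempty := by
  by_contra h
  rw [not_nonempty_iff_eq_empty] at h
  have := D.law_compl_types
  rw [h, compl_empty, measure_univ] at this
  exact one_ne_zero this

theorem cdf_eq_setIntegral (x : ℝ) : D.cdf x = ∫ t in Iic x, D.density t := by
  rw [cdf, Measure.real, law, withDensity_apply _ measurableSet_Iic,
    integral_eq_lintegral_of_nonneg_ae (Eventually.of_forall D.density_nonneg)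
      D.integrable_density.aestronglyMeasurable.restrict]

theorem cdf_sub_cdf (x y : ℝ) : D.cdf y - D.cdf x = ∫ t in x..y, D.density t := by
  rw [cdf_eq_setIntegral, cdf_eq_setIntegral]
  exact intervalIntegral.integral_Iic_sub_Iic D.integrable_density.integrableOn
    D.integrable_density.integrableOn

theorem monotone_cdf : Monotone D.cdf := fun _ _ h =>
  measureReal_mono (Iic_subset_Iic.2 h)

theorem cdf_nonneg (x : ℝ) : 0 ≤ D.cdf x := measureReal_nonneg

theorem cdf_le_one (x : ℝ) : D.cdf x ≤ 1 := measureReal_le_one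

theorem continuous_cdf : Continuous D.cdf := by
  have : D.cdf = fun y => D.cdf 0 + ∫ t in (0 : ℝ)..y, D.density t := by
    ext y; rw [← cdf_sub_cdf]; ring
  rw [this]
  exact continuous_const.add (intervalIntegral.continuous_primitive
    (fun a b => D.integrable_density.intervalIntegrable) 0)

theorem hasDerivAt_cdf {x : ℝ} (hx : x ∈ D.types) : HasDerivAt D.cdf (D.density x) x := by
  have : D.cdf = fun y => D.cdf 0 + ∫ t in (0 : ℝ)..y, D.density t := by
    ext y; rw [← cdf_sub_cdf]; ring
  rw [this]
  refine HasDerivAt.const_add _ (intervalIntegral.integral_hasDerivAt_right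
    D.integrable_density.intervalIntegrable ?_ ?_)
  · exact D.integrable_density.aestronglyMeasurable.stronglyMeasurableAtFilter
  · exact D.continuousOn_density.continuousAt (D.isOpen_types.mem_nhds hx)

theorem strictMonoOn_cdf : StrictMonoOn D.cdf D.types := by
  refine strictMonoOn_of_deriv_pos D.ordConnected_types.convex D.continuous_cdf.continuousOn ?_
  intro x hx
  rw [D.isOpen_types.interior_eq] at hx
  rw [(D.hasDerivAt_cdf hx).deriv]
  exact hx

theorem exists_lt_mem_types {x : ℝ} (hx : x ∈ D.types) : ∃ y ∈ D.types, y < x := by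
  obtain ⟨l, r, h, hs⟩ := mem_nhds_iff_exists_Ioo_subset.1 (D.isOpen_types.mem_nhds hx)
  obtain ⟨y, hy⟩ := exists_between h.1
  exact ⟨y, hs ⟨hy.1, hy.2.trans h.2⟩, hy.2⟩

theorem exists_gt_mem_types {x : ℝ} (hx : x ∈ D.types) : ∃ y ∈ D.types, x < y := by
  obtain ⟨l, r, h, hs⟩ := mem_nhds_iff_exists_Ioo_subset.1 (D.isOpen_types.mem_nhds hx)
  obtain ⟨y, hy⟩ := exists_between h.2
  exact ⟨y, hs ⟨h.1.trans hy.1, hy.2⟩, hy.1⟩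

theorem cdf_pos {x : ℝ} (hx : x ∈ D.types) : 0 < D.cdf x := by
  obtain ⟨y, hy, h⟩ := D.exists_lt_mem_types hx
  exact (D.cdf_nonneg y).trans_lt (D.strictMonoOn_cdf hy hx h)

theorem cdf_lt_one {x : ℝ} (hx : x ∈ D.types) : D.cdf x < 1 := by
  obtain ⟨y, hy, h⟩ := D.exists_gt_mem_types hx
  exact (D.strictMonoOn_cdf hx hy h).trans_le (D.cdf_le_one y)

theorem cdf_eq_zero {x : ℝ} (h : ∀ y ∈ D.types, x ≤ y) : D.cdf x = 0 := by
  have h1 : D.law (Iio x) = 0 := measure_mono_null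
    (fun y (hy : y < x) (hy' : y ∈ D.types) => (h y hy').not_gt hy) D.law_compl_types
  rw [cdf, measureReal_congr Iio_ae_eq_Iic.symm, Measure.real, h1, ENNReal.toReal_zero]

theorem cdf_eq_one {x : ℝ} (h : ∀ y ∈ D.types, y ≤ x) : D.cdf x = 1 := by
  have h1 : D.law (Iic x)ᶜ = 0 := measure_mono_null
    (fun y (hy : ¬ y ≤ x) (hy' : y ∈ D.types) => hy (h y hy')) D.law_compl_types
  rw [prob_compl_eq_zero_iff measurableSet_Iic] at h1
  rw [cdf, Measure.real, h1, ENNReal.toReal_one]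

theorem cdf_eq_zero_of_lt {x y : ℝ} (hx : x ∉ D.types) (hy : y ∈ D.types) (h : x < y) :
    D.cdf x = 0 :=
  D.cdf_eq_zero fun z hz => by
    by_contra! hzx
    exact hx (D.ordConnected_types.out hz hy ⟨hzx.le, h.le⟩)

theorem cdf_eq_one_of_gt {x y : ℝ} (hx : x ∉ D.types) (hy : y ∈ D.types) (h : y < x) :
    D.cdf x = 1 :=
  D.cdf_eq_one fun z hz => by
    by_contra! hzx
    exact hx (D.ordConnected_types.out hy hz ⟨h.le, hzx.le⟩)

theorem cdf_lt_cdf_iff {x y : ℝ} (hx : x ∈ D.types) : D.cdf y < D.cdf x ↔ y < x := by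
  refine ⟨fun h => D.monotone_cdf.reflect_lt h, fun h => ?_⟩
  by_cases hy : y ∈ D.types
  · exact D.strictMonoOn_cdf hy hx h
  · rw [D.cdf_eq_zero_of_lt hy hx h]
    exact D.cdf_pos hx

theorem exists_cdf_eq {u : ℝ} (h0 : 0 < u) (h1 : u < 1) : ∃ x ∈ D.types, D.cdf x = u := by
  have e : ∀ x, ProbabilityTheory.cdf D.law x = D.cdf x := fun x => cdf_eq_real _ _
  have hbot := tendsto_cdf_atBot D.law
  have htop := tendsto_cdf_atTop D.law
  obtain ⟨a, ha⟩ := (hbot.eventually (gt_mem_nhds h0)).exists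
  obtain ⟨b, hb⟩ := (htop.eventually (lt_mem_nhds h1)).exists
  rw [e] at ha hb
  obtain ⟨x, hx⟩ := mem_range_of_exists_le_of_exists_ge D.continuous_cdf ⟨a, ha.le⟩ ⟨b, hb.le⟩
  refine ⟨x, ?_, hx⟩
  by_contra hxt
  obtain ⟨y, hy⟩ := D.types_nonempty
  rcases lt_trichotomy x y with h | h | h
  · rw [D.cdf_eq_zero_of_lt hxt hy h] at hx; exact h0.ne hx
  · exact hxt (h ▸ hy)
  · rw [D.cdf_eq_one_of_gt hxt hy h] at hx; exact h1.ne' hx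

theorem quantile_one_sub_cdf {x : ℝ} (hx : x ∈ D.types) : D.quantile (1 - D.cdf x) = x := by
  refine IsLeast.csInf_eq ⟨?_, ?_⟩
  · simp
  · intro y hy
    have hy' : 1 - (1 - D.cdf x) ≤ D.cdf y := hy
    by_contra! h
    have := (D.cdf_lt_cdf_iff hx).2 h
    linarith

theorem sub_bounds_of_deriv_quantile {L' L : ℝ} (hL' : 0 < L')
    (hD : ∀ q ∈ Ioo (0 : ℝ) 1, L' ≤ |deriv D.quantile q| ∧ |deriv D.quantile q| ≤ L)
    {x y : ℝ} (hx : x ∈ D.types) (hy : y ∈ D.types) (hxy : x < y) :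
    L' * (D.cdf y - D.cdf x) ≤ y - x ∧ y - x ≤ L * (D.cdf y - D.cdf x) := by
  have hlt := D.strictMonoOn_cdf hx hy hxy
  -- `deriv` takes the value `0` where there is no derivative, so the positive lower bound `L'`
  -- forces differentiability.
  have hd : ∀ q ∈ Ioo (0 : ℝ) 1, DifferentiableAt ℝ D.quantile q := by
    intro q hq
    by_contra h
    have := (hD q hq).1
    rw [deriv_zero_of_not_differentiableAt h, abs_zero] at this
    linarith
  have hsub : Icc (1 - D.cdf y) (1 - D.cdf x) ⊆ Ioo 0 1 := fun q hq =>
    ⟨by linarith [hq.1, D.cdf_lt_one hy], by linarith [hq.2, D.cdf_pos hx]⟩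
  obtain ⟨c, hc, h⟩ := exists_deriv_eq_slope D.quantile
    (show 1 - D.cdf y < 1 - D.cdf x by linarith)
    (fun q hq => (hd q (hsub hq)).continuousAt.continuousWithinAt)
    (fun q hq => (hd q (hsub (Ioo_subset_Icc_self hq))).differentiableWithinAt)
  have hb := hD c (hsub (Ioo_subset_Icc_self hc))
  rw [D.quantile_one_sub_cdf hx, D.quantile_one_sub_cdf hy] at h
  have hpos : 0 < D.cdf y - D.cdf x := by linarith
  have : |deriv D.quantile c| = (y - x) / (D.cdf y - D.cdf x) := by
    rw [h, show 1 - D.cdf x - (1 - D.cdf y) = D.cdf y - D.cdf x by ring, abs_div,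
      abs_of_pos hpos, abs_sub_comm, abs_of_pos (by linarith)]
  rw [this, le_div_iff₀ hpos, div_le_iff₀ hpos] at hb
  exact hb

/-- Abilities are positive and `v` has slope at least `L'` in size, so the median is at least `L' /
2`. Above the median there remains mass `1 / 2`, hence length at most `|L| / 2`, which is a multiple
of the median. -/
theorem le_mul_median {L' L : ℝ} (hL' : 0 < L')
    (hD : ∀ q ∈ Ioo (0 : ℝ) 1, L' ≤ |deriv D.quantile q| ∧ |deriv D.quantile q| ≤ L)
    {x y : ℝ} (hx : x ∈ D.types) (hx2 : D.cdf x = 1 / 2) (hy : y ∈ D.types) :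
    y ≤ (1 + |L| / L') * x := by
  have h0 : 0 < x := D.pos_of_mem_types hx
  have hmed : L' / 2 ≤ x := by
    by_contra! h
    have hpos : 0 < 1 / 2 - x / L' := by
      have : x / L' < 1 / 2 := by rw [div_lt_iff₀ hL']; linarith
      linarith
    -- The quantile level is chosen so that the slope bound gives `x - z ≥ x`, contradicting `0 <
    -- z`.
    obtain ⟨z, hz, hzu⟩ := D.exists_cdf_eq hpos (by have := div_pos h0 hL'; linarith)
    have hzx : z < x := by
      rw [← D.cdf_lt_cdf_iff hx, hzu, hx2]
      have := div_pos h0 hL'; linarith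
    have := (D.sub_bounds_of_deriv_quantile hL' hD hz hx hzx).1
    rw [hzu, hx2, show (1 : ℝ) / 2 - (1 / 2 - x / L') = x / L' by ring,
      mul_div_cancel₀ _ hL'.ne'] at this
    linarith [D.pos_of_mem_types hz]
  have hLx : |L| / 2 ≤ |L| / L' * x := by
    rw [div_mul_eq_mul_div, div_le_div_iff₀ two_pos hL']
    nlinarith [abs_nonneg L]
  rcases le_or_gt y x with h | h
  · nlinarith [abs_nonneg L]
  · have h1 := (D.sub_bounds_of_deriv_quantile hL' hD hx hy h).2
    have h2 := D.cdf_le_one y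
    have h3 : L * (D.cdf y - D.cdf x) ≤ |L| * (1 / 2) :=
      mul_le_mul (le_abs_self L) (by linarith) (by linarith [D.monotone_cdf h.le]) (abs_nonneg L)
    linarith

theorem cdf_sInf_types : D.cdf (sInf D.types) = 0 :=
  D.cdf_eq_zero fun _ hy => csInf_le ⟨0, fun _ hz => (D.pos_of_mem_types hz).le⟩ hy

theorem eventually_mem_types : ∀ᶠ x in 𝓝[>] (sInf D.types), x ∈ D.types := by
  obtain ⟨y, hy⟩ := D.types_nonempty
  have hlt : sInf D.types < y := by
    obtain ⟨z, hz, hzy⟩ := D.exists_lt_mem_types hy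
    exact (csInf_le ⟨0, fun _ hz => (D.pos_of_mem_types hz).le⟩ hz).trans_lt hzy
  filter_upwards [Ioo_mem_nhdsGT hlt] with x hx
  obtain ⟨z, hz, hzx⟩ := exists_lt_of_csInf_lt D.types_nonempty hx.1
  exact D.ordConnected_types.out hz hy ⟨hzx.le, hx.2.le⟩

theorem tendsto_cdf_bottom : Tendsto D.cdf (𝓝[>] (sInf D.types)) (𝓝 0) := by
  have := D.continuous_cdf.tendsto (sInf D.types)
  rw [D.cdf_sInf_types] at this
  exact this.mono_left nhdsWithin_le_nhds

theorem cdf_nonpos {x : ℝ} (hx : x ≤ 0) : D.cdf x = 0 :=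
  D.cdf_eq_zero fun _ hy => hx.trans (D.pos_of_mem_types hy).le

end AbilityDistribution

/-! ### Shortlisting events and their probabilities. -/

/-- The profiles in which contestant `i` is shortlisted if her ability is `x`. -/
def shortlisted {n : ℕ} (m : ℕ) (i : Fin n) (x : ℝ) : Set (Fin n → ℝ) :=
  {y | i ∈ shortlist m (Function.update y i x)}

/-- The profiles in which the abilities of all contestants other than `i` lie in `S`. -/
def othersIn {n : ℕ} (i : Fin n) (S : Set ℝ) : Set (Fin n → ℝ) :=
  {y | ∀ j, j ≠ i → y j ∈ S}

/-- The profiles in which `j` has an ability in `T` and all others but `i` have one in `S`. -/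
def oneIn {n : ℕ} (i j : Fin n) (S T : Set ℝ) : Set (Fin n → ℝ) :=
  Set.pi univ fun l => if l = i then univ else if l = j then T else S

theorem mem_shortlisted {n m : ℕ} {i : Fin n} {x : ℝ} {y : Fin n → ℝ} :
    y ∈ shortlisted m i x ↔ (Finset.univ.filter fun j => j ≠ i ∧ x < y j).card < m := by
  have : (Finset.univ.filter fun j => Function.update y i x i < Function.update y i x j) =
      Finset.univ.filter fun j => j ≠ i ∧ x < y j := by
    ext j
    by_cases h : j = i
    · subst h; simp
    · simp [h]
  simp only [shortlisted, shortlist, mem_ofPred_eq, Finset.mem_filter, Finset.mem_univ, true_and]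
  rw [this]

theorem othersIn_eq_pi {n : ℕ} (i : Fin n) (S : Set ℝ) :
    othersIn i S = Set.pi univ fun j => if j = i then univ else S := by
  ext y
  simp only [othersIn, mem_ofPred_eq, Set.mem_pi, mem_univ, true_implies]
  refine forall_congr' fun j => ?_
  by_cases h : j = i <;> simp [h]

theorem othersIn_mono {n : ℕ} (i : Fin n) {S T : Set ℝ} (h : S ⊆ T) :
    othersIn i S ⊆ othersIn i T := fun _ hy j hj => h (hy j hj)

theorem measurableSet_othersIn {n : ℕ} (i : Fin n) {S : Set ℝ} (hS : MeasurableSet S) :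
    MeasurableSet (othersIn i S) := by
  rw [othersIn_eq_pi]
  refine MeasurableSet.univ_pi fun j => ?_
  split_ifs <;> simp [hS]

theorem measurableSet_oneIn {n : ℕ} (i j : Fin n) {S T : Set ℝ} (hS : MeasurableSet S)
    (hT : MeasurableSet T) : MeasurableSet (oneIn i j S T) := by
  refine MeasurableSet.univ_pi fun j => ?_
  split_ifs <;> simp [hS, hT]

theorem othersIn_Iic_subset_shortlisted {n m : ℕ} (hm : 0 < m) (i : Fin n) (x : ℝ) :
    othersIn i (Iic x) ⊆ shortlisted m i x := by
  intro y hy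
  rw [mem_shortlisted, Finset.filter_eq_empty_iff.2, Finset.card_empty]
  · exact hm
  · rintro j - ⟨hj, hlt⟩
    exact hlt.not_ge (hy j hj)

theorem shortlisted_self {n : ℕ} (i : Fin n) (x : ℝ) : shortlisted n i x = univ := by
  refine eq_univ_of_forall fun y => mem_shortlisted.2 ?_
  calc _ < (Finset.univ : Finset (Fin n)).card := Finset.card_lt_card
        ⟨Finset.filter_subset _ _, fun h => by simpa using h (Finset.mem_univ i)⟩
    _ = n := by simp

/-- Being among the top two means that at most one rival is stronger, so the event splits according
to who that rival is. For `T` above `x` the pieces are disjoint products, which makes the posterior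
explicit. -/
theorem shortlisted_two_inter {n : ℕ} (i : Fin n) (x : ℝ) (T : Set ℝ) :
    shortlisted 2 i x ∩ othersIn i (Iic x ∪ T) =
      othersIn i (Iic x) ∪ ⋃ j ∈ Finset.univ.erase i, oneIn i j (Iic x) T := by
  ext y
  simp only [mem_inter_iff, mem_shortlisted, mem_union, mem_iUnion]
  constructor
  · rintro ⟨hc, hy⟩
    by_cases h : ∃ j, j ≠ i ∧ x < y j
    · obtain ⟨j, hj, hlt⟩ := h
      refine Or.inr ⟨j, by simpa using hj, fun l _ => ?_⟩
      rw [Nat.lt_succ_iff, Finset.card_le_one] at hc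
      dsimp only
      split_ifs with h1 h2
      · trivial
      · subst h2
        exact (hy l h1).resolve_left (not_le.2 hlt)
      · by_contra hl
        exact h2 (hc l (by simpa using ⟨h1, not_le.1 hl⟩) j (by simpa using ⟨hj, hlt⟩))
    · push Not at h
      exact Or.inl fun j hj => h j hj
  · rintro (h | ⟨j, hj, h⟩)
    · exact ⟨mem_shortlisted.1 (othersIn_Iic_subset_shortlisted two_pos i x h),
        othersIn_mono i subset_union_left h⟩
    · have hj : j ≠ i := by simpa using hj
      have key : ∀ l, l ≠ i → l ≠ j → y l ≤ x := fun l h1 h2 => by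
        simpa [h1, h2] using h l (mem_univ l)
      have keyj : y j ∈ T := by simpa [hj] using h j (mem_univ j)
      constructor
      · have : Nonempty (Fin n) := ⟨i⟩
        rw [Nat.lt_succ_iff, Finset.card_le_one_iff_subset_singleton]
        refine ⟨j, fun l hl => ?_⟩
        simp only [Finset.mem_filter, Finset.mem_univ, true_and] at hl
        by_contra hlj
        exact (key l hl.1 (by simpa using hlj)).not_gt hl.2
      · intro l hl
        by_cases hlj : l = j
        · exact Or.inr (hlj ▸ keyj)
        · exact Or.inl (key l hl hlj)

namespace AbilityDistribution

variable (D : AbilityDistribution)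

theorem profileLaw_real_pi {n : ℕ} (s : Fin n → Set ℝ) :
    (D.profileLaw n).real (Set.pi univ s) = ∏ j, D.law.real (s j) := by
  simp only [profileLaw, Measure.real, Measure.pi_pi, ENNReal.toReal_prod]

theorem profileLaw_real_forall_le (n : ℕ) (z : ℝ) :
    (D.profileLaw n).real {y | ∀ j, y j ≤ z} = D.cdf z ^ n := by
  have : {y : Fin n → ℝ | ∀ j, y j ≤ z} = Set.pi univ fun _ => Iic z := by
    ext y; simp [Pi.le_def]
  rw [this, profileLaw_real_pi]
  simp [cdf]

theorem profileLaw_real_othersIn {n : ℕ} (i : Fin n) (S : Set ℝ) :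
    (D.profileLaw n).real (othersIn i S) = D.law.real S ^ (n - 1) := by
  rw [othersIn_eq_pi, profileLaw_real_pi, ← Finset.mul_prod_erase _ _ (Finset.mem_univ i)]
  rw [Finset.prod_congr rfl (g := fun _ => D.law.real S)
    (fun j hj => by rw [if_neg (Finset.ne_of_mem_erase hj)])]
  simp

theorem profileLaw_real_oneIn {n : ℕ} {i j : Fin n} (hij : j ≠ i) (S T : Set ℝ) :
    (D.profileLaw n).real (oneIn i j S T) = D.law.real T * D.law.real S ^ (n - 2) := by
  have hj : j ∈ Finset.univ.erase i := by simpa using hij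
  rw [oneIn, profileLaw_real_pi, ← Finset.mul_prod_erase _ _ (Finset.mem_univ i),
    ← Finset.mul_prod_erase _ _ hj]
  rw [Finset.prod_congr rfl (g := fun _ => D.law.real S)
    (fun l hl => by
      rw [if_neg (Finset.ne_of_mem_erase (Finset.mem_of_mem_erase hl)),
        if_neg (Finset.ne_of_mem_erase hl)])]
  simp [hij, Nat.sub_sub]

theorem profileLaw_real_shortlisted_two_inter {n : ℕ} (i : Fin n) {x : ℝ} {T : Set ℝ}
    (hTm : MeasurableSet T) (hT : T ⊆ Ioi x) :
    (D.profileLaw n).real (shortlisted 2 i x ∩ othersIn i (Iic x ∪ T)) =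
      D.cdf x ^ (n - 1) + (n - 1) * (D.law.real T * D.cdf x ^ (n - 2)) := by
  have hone : ∀ j ∈ Finset.univ.erase i, ∀ y ∈ oneIn i j (Iic x) T, x < y j := by
    intro j hj y hy
    have hj : j ≠ i := by simpa using hj
    exact hT (by simpa [hj] using hy j (mem_univ j))
  have hm : MeasurableSet (⋃ j ∈ Finset.univ.erase i, oneIn i j (Iic x) T) :=
    Finset.measurableSet_biUnion _ fun j _ => measurableSet_oneIn i j measurableSet_Iic hTm
  rw [shortlisted_two_inter, measureReal_union ?_ hm (measure_ne_top _ _)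
    (measure_ne_top _ _)]
  · rw [measureReal_biUnion_finset]
    · rw [profileLaw_real_othersIn, Finset.sum_congr rfl
        (fun j hj => D.profileLaw_real_oneIn (by simpa using hj) _ _)]
      have : 1 ≤ n := i.pos
      simp [cdf, Nat.cast_sub this]
    · intro j hj l hl hjl
      refine Set.disjoint_left.2 fun y h1 h2 => (hone j hj y h1).not_ge ?_
      have hj : j ≠ i := by simpa using hj
      simpa [hj, hjl] using h2 j (mem_univ j)
    · exact fun j _ => measurableSet_oneIn i j measurableSet_Iic hTm
  · rw [Set.disjoint_iUnion₂_right]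
    intro j hj
    exact Set.disjoint_left.2 fun y h1 h2 =>
      (hone j hj y h2).not_ge (h1 j (by simpa using hj))

end AbilityDistribution

theorem measurableSet_shortlisted {n : ℕ} (m : ℕ) (i : Fin n) (x : ℝ) :
    MeasurableSet (shortlisted m i x) := by
  have : shortlisted m i x =
      {y | ∑ j : Fin n, (if j ≠ i ∧ x < y j then 1 else 0) < m} := by
    ext y
    rw [mem_shortlisted, Finset.card_filter]
    rfl
  rw [this]
  refine measurableSet_lt (Finset.measurable_sum _ fun j _ => ?_) measurable_const
  refine Measurable.ite ?_ measurable_const measurable_const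
  by_cases h : j = i
  · simp [h]
  · simpa [h] using measurableSet_lt measurable_const (measurable_pi_apply j)

/-- The posterior probability that all others have at most ability `z`. -/
noncomputable def oddsBelow (D : AbilityDistribution) (n m : ℕ) (i : Fin n) (x z : ℝ) : ℝ :=
  (posterior D n m i x).real (othersIn i (Iic z))

/-! ### The posterior and the law of the strongest rival. -/

section posterior

variable {D : AbilityDistribution} {n m : ℕ} {i : Fin n} {x : ℝ}

theorem profileLaw_shortlisted_pos (hm : 0 < m) (hx : x ∈ D.types) :
    0 < (D.profileLaw n).real (shortlisted m i x) := by
  refine lt_of_lt_of_le ?_ (measureReal_mono (othersIn_Iic_subset_shortlisted hm i x))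
  rw [D.profileLaw_real_othersIn]
  exact pow_pos (D.cdf_pos hx) _

theorem isProbabilityMeasure_posterior (hm : 0 < m) (hx : x ∈ D.types) :
    IsProbabilityMeasure (posterior D n m i x) := by
  refine cond_isProbabilityMeasure ?_
  intro h
  have := profileLaw_shortlisted_pos (n := n) (i := i) hm hx
  rw [Measure.real, shortlisted, h] at this
  simp at this

theorem posterior_real_apply (S : Set (Fin n → ℝ)) :
    (posterior D n m i x).real S =
      (D.profileLaw n).real (shortlisted m i x ∩ S) /
        (D.profileLaw n).real (shortlisted m i x) := by
  have h : posterior D n m i x = ProbabilityTheory.cond (D.profileLaw n) (shortlisted m i x) := rfl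
  rw [h, Measure.real, cond_apply (measurableSet_shortlisted m i x), ENNReal.toReal_mul,
    ENNReal.toReal_inv, div_eq_inv_mul]
  rfl

theorem posterior_absolutelyContinuous : posterior D n m i x ≪ D.profileLaw n :=
  cond_absolutelyContinuous

theorem ae_posterior_mem_types : ∀ᵐ y ∂(posterior D n m i x), ∀ j, y j ∈ D.types := by
  refine posterior_absolutelyContinuous.ae_le (ae_all_iff.2 fun j => ?_)
  exact (Measure.quasiMeasurePreserving_eval (fun _ : Fin n => D.law) j).ae
    (mem_ae_iff.2 D.law_compl_types)

theorem ae_posterior_ne (z : ℝ) : ∀ᵐ y ∂(posterior D n m i x), ∀ j, y j ≠ z := by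
  refine posterior_absolutelyContinuous.ae_le (ae_all_iff.2 fun j => ?_)
  refine (Measure.quasiMeasurePreserving_eval (fun _ : Fin n => D.law) j).ae
    (p := fun t => t ≠ z) ?_
  rw [ae_iff]
  simp

theorem posterior_real_othersIn_Ioc_pos (hm : 0 < m) {z : ℝ} (hz : z ∈ D.types)
    (hx : x ∈ D.types) (hzx : z < x) :
    0 < (posterior D n m i x).real (othersIn i (Ioc z x)) := by
  rw [posterior_real_apply, inter_eq_self_of_subset_right]
  · refine div_pos ?_ (profileLaw_shortlisted_pos hm hx)
    rw [D.profileLaw_real_othersIn, ← Iic_sdiff_Iic,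
      measureReal_sdiff (Iic_subset_Iic.2 hzx.le) measurableSet_Iic]
    exact pow_pos (sub_pos.2 (D.strictMonoOn_cdf hz hx hzx)) _
  · exact (othersIn_mono i Ioc_subset_Iic_self).trans (othersIn_Iic_subset_shortlisted hm i x)

/-- With everyone shortlisted the conditioning is void, and the result does not depend on `x`. This
independence is what makes the `n`-contestant contest easier than the other one. -/
theorem oddsBelow_self (z : ℝ) : oddsBelow D n n i x z = D.cdf z ^ (n - 1) := by
  rw [oddsBelow, posterior_real_apply, shortlisted_self, univ_inter, probReal_univ, div_one,
    D.profileLaw_real_othersIn]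
  rfl

theorem profileLaw_shortlisted_two (hn : 2 ≤ n) :
    (D.profileLaw n).real (shortlisted 2 i x) =
      D.cdf x ^ (n - 2) * ((n - 1) * (1 - D.cdf x) + D.cdf x) := by
  have h := D.profileLaw_real_shortlisted_two_inter i measurableSet_Ioi (Subset.refl (Ioi x))
  have hu : othersIn i (Iic x ∪ Ioi x) = univ := by
    rw [Iic_union_Ioi]; exact eq_univ_of_forall fun y j _ => mem_univ _
  rw [hu, inter_univ, ← compl_Iic, probReal_compl_eq_one_sub measurableSet_Iic] at h
  rw [h, show n - 1 = n - 2 + 1 by omega, pow_succ]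
  change _ + _ * ((1 - D.cdf x) * _) = _
  ring

theorem oddsBelow_two_of_le (hn : 2 ≤ n) {z : ℝ} (hxz : x ≤ z) :
    oddsBelow D n 2 i x z =
      D.cdf x ^ (n - 2) * ((n - 1) * (D.cdf z - D.cdf x) + D.cdf x) /
      (D.cdf x ^ (n - 2) * ((n - 1) * (1 - D.cdf x) + D.cdf x)) := by
  have h := D.profileLaw_real_shortlisted_two_inter i measurableSet_Ioc
    (Ioc_subset_Ioi_self : Ioc x z ⊆ Ioi x)
  rw [Iic_union_Ioc_eq_Iic hxz, ← Iic_sdiff_Iic,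
    measureReal_sdiff (Iic_subset_Iic.2 hxz) measurableSet_Iic] at h
  rw [oddsBelow, posterior_real_apply, profileLaw_shortlisted_two hn, h,
    show n - 1 = n - 2 + 1 by omega, pow_succ]
  congr 1
  change _ + _ * ((D.cdf z - D.cdf x) * _) = _
  ring

theorem oddsBelow_two_of_ge (hn : 2 ≤ n) {z : ℝ} (hzx : z ≤ x) :
    oddsBelow D n 2 i x z = D.cdf z ^ (n - 1) /
      (D.cdf x ^ (n - 2) * ((n - 1) * (1 - D.cdf x) + D.cdf x)) := by
  rw [oddsBelow, posterior_real_apply, profileLaw_shortlisted_two hn,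
    inter_eq_self_of_subset_right, D.profileLaw_real_othersIn]
  · rfl
  · exact (othersIn_mono i (Iic_subset_Iic.2 hzx)).trans
      (othersIn_Iic_subset_shortlisted two_pos i x)

end posterior

/-! ### The hazard rate of the strongest rival. -/

/-- The hazard rate `(n - 1) / ((n - 1) (1 - u) + u)` of the strongest rival at the quantile `u`,
given that at most one of the rivals is above it. -/
noncomputable def rivalRate (n : ℕ) (u : ℝ) : ℝ := (n - 1) / (n - 1 - (n - 2) * min u 1)

/-- The truncation `min u 1` keeps the denominator at least `1` for every real `u`, so the rate is
positive and continuous on the whole line. -/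
theorem rivalRate_denom_pos {n : ℕ} (hn : 2 ≤ n) (u : ℝ) :
    0 < (n : ℝ) - 1 - (n - 2) * min u 1 := by
  have h2 : (2 : ℝ) ≤ n := by exact_mod_cast hn
  nlinarith [min_le_right u 1]

theorem rivalRate_pos {n : ℕ} (hn : 2 ≤ n) (u : ℝ) : 0 < rivalRate n u := by
  have h2 : (2 : ℝ) ≤ n := by exact_mod_cast hn
  exact div_pos (by linarith) (rivalRate_denom_pos hn u)

theorem continuous_rivalRate {n : ℕ} (hn : 2 ≤ n) : Continuous (rivalRate n) :=
  continuous_const.div (by fun_prop) fun u => (rivalRate_denom_pos hn u).ne'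

theorem rivalRate_of_le_one (n : ℕ) {u : ℝ} (hu : u ≤ 1) :
    rivalRate n u = (n - 1) / ((n - 1) * (1 - u) + u) := by
  rw [rivalRate, min_eq_left hu]; ring

/-- The convex function `t ^ (N + 1)` lies above its tangent at `u`. -/
theorem sub_pow_le {u w : ℝ} (hu : 0 ≤ u) (hw : 0 ≤ w) (N : ℕ) :
    u ^ (N + 1) - w ^ (N + 1) ≤ (N + 1) * u ^ N * (u - w) := by
  induction N with
  | zero => simp
  | succ N ih =>
    have h1 : 0 ≤ (u - w) * (u ^ (N + 1) - w ^ (N + 1)) := by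
      rcases le_total u w with h | h
      · exact mul_nonneg_of_nonpos_of_nonpos (by linarith)
          (by linarith [pow_le_pow_left₀ hu h (N + 1)])
      · exact mul_nonneg (by linarith) (by linarith [pow_le_pow_left₀ hw h (N + 1)])
    have h2 := mul_le_mul_of_nonneg_left ih hu
    push_cast
    have e1 : u ^ (N + 1 + 1) - w ^ (N + 1 + 1) =
        u * (u ^ (N + 1) - w ^ (N + 1)) + w ^ (N + 1) * (u - w) := by ring
    have e2 : ((N : ℝ) + 1 + 1) * u ^ (N + 1) * (u - w) =
        u * ((N + 1) * u ^ N * (u - w)) + u ^ (N + 1) * (u - w) := by ring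
    rw [e1, e2]
    nlinarith

section posterior

variable {D : AbilityDistribution} {n : ℕ} {i : Fin n} {x : ℝ}

theorem oddsBelow_two_self (hn : 2 ≤ n) (hx : x ∈ D.types) :
    oddsBelow D n 2 i x x = D.cdf x * rivalRate n (D.cdf x) / (n - 1) := by
  have h2 : (2 : ℝ) ≤ n := by exact_mod_cast hn
  have h0 := D.cdf_pos hx
  have h1 := D.cdf_lt_one hx
  have hd : 0 < (n - 1) * (1 - D.cdf x) + D.cdf x := by nlinarith
  rw [oddsBelow_two_of_le hn le_rfl, rivalRate_of_le_one n h1.le, sub_self, mul_zero, zero_add]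
  have : (n : ℝ) - 1 ≠ 0 := by linarith
  field_simp

/-- As a function of `F z`, the odds are affine above `F x` and a multiple of a convex power below
it, with matching slopes. So the tangent at `F x` is a global lower bound. -/
theorem rivalRate_mul_le_oddsBelow_sub (hn : 2 ≤ n) (hx : x ∈ D.types) (z : ℝ) :
    rivalRate n (D.cdf x) * (D.cdf z - D.cdf x) ≤
      oddsBelow D n 2 i x z - oddsBelow D n 2 i x x := by
  have h2 : (2 : ℝ) ≤ n := by exact_mod_cast hn
  have h0 := D.cdf_pos hx
  have h1 := D.cdf_lt_one hx
  have hd : 0 < (n - 1) * (1 - D.cdf x) + D.cdf x := by nlinarith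
  have hp : 0 < D.cdf x ^ (n - 2) := pow_pos h0 _
  rw [rivalRate_of_le_one n h1.le]
  rcases le_total x z with h | h
  · rw [oddsBelow_two_of_le hn h, oddsBelow_two_of_le hn le_rfl]
    refine le_of_eq ?_
    field_simp
    ring
  · rw [oddsBelow_two_of_ge hn h, oddsBelow_two_of_ge hn le_rfl, ← sub_div, div_mul_eq_mul_div,
      div_le_div_iff₀ hd (by positivity)]
    obtain ⟨N, rfl⟩ := Nat.exists_eq_add_of_le' hn
    have := sub_pow_le h0.le (D.cdf_nonneg z) N
    have e : ((N + 2 : ℕ) : ℝ) = N + 2 := by push_cast; ring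
    simp only [e, Nat.add_sub_cancel, show N + 2 - 1 = N + 1 by omega] at *
    nlinarith

/-- The formulas for the odds on the two sides of `x` differ, but their one-sided derivatives at `x`
agree. -/
theorem hasDerivAt_oddsBelow_two (hn : 2 ≤ n) (hx : x ∈ D.types) :
    HasDerivAt (oddsBelow D n 2 i x) (rivalRate n (D.cdf x) * D.density x) x := by
  have h2 : (2 : ℝ) ≤ n := by exact_mod_cast hn
  have h0 := D.cdf_pos hx
  have h1 := D.cdf_lt_one hx
  have hd : 0 < (n - 1) * (1 - D.cdf x) + D.cdf x := by nlinarith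
  have hF := D.hasDerivAt_cdf hx
  rw [rivalRate_of_le_one n h1.le]
  rw [← hasDerivWithinAt_univ, ← Iic_union_Ici (a := x)]
  refine HasDerivWithinAt.union ?_ ?_
  · have := ((hF.fun_pow (n - 1)).div_const
      (D.cdf x ^ (n - 2) * ((n - 1) * (1 - D.cdf x) + D.cdf x))).hasDerivWithinAt (s := Iic x)
    refine (this.congr (fun z hz => oddsBelow_two_of_ge hn hz)
      (oddsBelow_two_of_ge hn le_rfl)).congr_deriv ?_
    rw [Nat.cast_sub (by omega), show n - 1 - 1 = n - 2 by omega]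
    push_cast
    field_simp
  · have := (((((hF.sub_const (D.cdf x)).const_mul ((n : ℝ) - 1)).add_const (D.cdf x)).const_mul
      (D.cdf x ^ (n - 2))).div_const
      (D.cdf x ^ (n - 2) * ((n - 1) * (1 - D.cdf x) + D.cdf x))).hasDerivWithinAt (s := Ici x)
    refine (this.congr (fun z hz => oddsBelow_two_of_le hn hz)
      (oddsBelow_two_of_le hn le_rfl)).congr_deriv ?_
    field_simp

end posterior

/-! ### The winner's share for a given profile. -/

section share

variable {n m : ℕ} {b : ℝ → ℝ} {i : Fin n} {e x : ℝ}

/-- Only contestant `i` can be above the strongest rival, who is thus always shortlisted. Under a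
monotone effort function, winning may therefore be judged against all rivals instead of the
shortlisted ones. -/
theorem exists_shortlisted_rival (hm : 2 ≤ m) {y : Fin n → ℝ} {j : Fin n} (hj : j ≠ i) :
    ∃ l ∈ (shortlist m y).erase i, y j ≤ y l := by
  obtain ⟨l, hl, hmax⟩ := (Finset.univ.erase i).exists_max_image y ⟨j, by simpa using hj⟩
  refine ⟨l, Finset.mem_erase.2 ⟨Finset.ne_of_mem_erase hl, ?_⟩, hmax j (by simpa using hj)⟩
  have hsub : (Finset.univ.filter fun k => y l < y k) ⊆ {i} := by
    intro k hk
    by_contra hki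
    exact (hmax k (by simpa using hki)).not_gt (by simpa using hk)
  have := Finset.card_le_card hsub
  simp only [shortlist, Finset.mem_filter, Finset.mem_univ, true_and]
  rw [Finset.card_singleton] at this
  omega

theorem rankShare_eq_one {y : Fin n → ℝ} (h : ∀ j, j ≠ i → b (y j) < e) :
    rankShare m b i e y 1 = 1 := by
  have h0 : numAbove m b i e y = 0 := by
    rw [numAbove, Finset.card_eq_zero, Finset.filter_eq_empty_iff]
    exact fun j hj => (h j (Finset.ne_of_mem_erase hj)).le.not_gt
  have h1 : numTied m b i e y = 0 := by
    rw [numTied, Finset.card_eq_zero, Finset.filter_eq_empty_iff]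
    exact fun j hj => (h j (Finset.ne_of_mem_erase hj)).ne
  simp [rankShare, h0, h1]

theorem rankShare_nonneg (y : Fin n → ℝ) (r : ℕ) : 0 ≤ rankShare m b i e y r := by
  unfold rankShare
  split_ifs <;> positivity

theorem rankShare_le_one (y : Fin n → ℝ) (r : ℕ) : rankShare m b i e y r ≤ 1 := by
  unfold rankShare
  split_ifs
  · exact div_le_one_of_le₀ (by simp) (by positivity)
  · exact zero_le_one

theorem rankShare_eq_zero (hm : 2 ≤ m) (hb : Monotone b) {y : Fin n → ℝ}
    (h : ∃ j, j ≠ i ∧ e < b (y j)) : rankShare m b i e y 1 = 0 := by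
  obtain ⟨j, hj, he⟩ := h
  obtain ⟨l, hl, hjl⟩ := exists_shortlisted_rival hm (y := y) hj
  have : 0 < numAbove m b i e y :=
    Finset.card_pos.2 ⟨l, Finset.mem_filter.2 ⟨hl, he.trans_le (hb hjl)⟩⟩
  rw [rankShare, if_neg]
  omega

theorem rankShare_le_half (hm : 2 ≤ m) (hb : Monotone b) {y : Fin n → ℝ}
    (h : ∃ j, j ≠ i ∧ e ≤ b (y j)) : rankShare m b i e y 1 ≤ 1 / 2 := by
  by_cases h' : ∃ j, j ≠ i ∧ e < b (y j)
  · rw [rankShare_eq_zero hm hb h']; norm_num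
  push Not at h'
  obtain ⟨j, hj, he⟩ := h
  obtain ⟨l, hl, hjl⟩ := exists_shortlisted_rival hm (y := y) hj
  have : 1 ≤ numTied m b i e y := Finset.card_pos.2 ⟨l, Finset.mem_filter.2
    ⟨hl, (h' l (Finset.ne_of_mem_erase hl)).antisymm (he.trans (hb hjl))⟩⟩
  have : (1 : ℝ) ≤ numTied m b i e y := by exact_mod_cast this
  unfold rankShare
  split_ifs
  · exact one_div_le_one_div_of_le two_pos (by linarith)
  · norm_num

theorem measurableSet_mem_shortlist (m : ℕ) (j : Fin n) :
    MeasurableSet {y : Fin n → ℝ | j ∈ shortlist m y} := by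
  have : {y : Fin n → ℝ | j ∈ shortlist m y} =
      {y | ∑ l : Fin n, (if y j < y l then 1 else 0) < m} := by
    ext y
    rw [mem_ofPred_eq, mem_ofPred_eq, ← Finset.card_filter]
    simp [shortlist]
  rw [this]
  refine measurableSet_lt (Finset.measurable_sum _ fun l _ => ?_) measurable_const
  exact Measurable.ite (measurableSet_lt (measurable_pi_apply j) (measurable_pi_apply l))
    measurable_const measurable_const

theorem measurable_card_filter_shortlist (m : ℕ) (i : Fin n) {S : Set ℝ} [DecidablePred (· ∈ S)]
    (hS : MeasurableSet S) :
    Measurable fun y : Fin n → ℝ => (((shortlist m y).erase i).filter fun j => y j ∈ S).card := by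
  classical
  have : (fun y : Fin n → ℝ => (((shortlist m y).erase i).filter fun j => y j ∈ S).card) =
      fun y => ∑ j ∈ Finset.univ.erase i,
        (if y ∈ {y : Fin n → ℝ | j ∈ shortlist m y} ∩ (fun y => y j) ⁻¹' S then 1 else 0) := by
    ext y
    rw [← Finset.card_filter]
    congr 1
    ext j
    simp only [Finset.mem_filter, Finset.mem_erase, Finset.mem_univ, and_true, mem_inter_iff,
      mem_ofPred_eq, mem_preimage, and_assoc]
  rw [this]
  refine Finset.measurable_sum _ fun j _ => Measurable.ite ?_ measurable_const measurable_const
  exact (measurableSet_mem_shortlist m j).inter (measurable_pi_apply j hS)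

theorem measurable_numAbove (m : ℕ) (hb : Measurable b) (i : Fin n) (e : ℝ) :
    Measurable (numAbove m b i e) := by
  classical
  convert measurable_card_filter_shortlist m i (hb (measurableSet_Ioi (a := e))) using 2
  rw [numAbove]
  refine congrArg Finset.card ?_
  ext j
  simp

theorem measurable_numTied (m : ℕ) (hb : Measurable b) (i : Fin n) (e : ℝ) :
    Measurable (numTied m b i e) := by
  classical
  convert measurable_card_filter_shortlist m i (hb (measurableSet_singleton e)) using 2
  rw [numTied]
  refine congrArg Finset.card ?_
  ext j
  simp

theorem measurable_rankShare (m : ℕ) (hb : Measurable b) (i : Fin n) (e : ℝ) (r : ℕ) :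
    Measurable fun y => rankShare m b i e y r := by
  have h1 := measurable_numAbove m hb i e
  have h2 := measurable_numTied m hb i e
  refine Measurable.ite ?_ ?_ measurable_const
  · exact (measurableSet_lt h1 measurable_const).inter
      (measurableSet_le measurable_const ((h1.add h2).add_const 1))
  · exact measurable_const.div ((measurable_from_top.comp h2).add_const 1)

end share

/-! ### Winning probabilities. -/

section rankProb

variable {D : AbilityDistribution} {n m : ℕ} {b : ℝ → ℝ} {i : Fin n} {x : ℝ}

theorem integrable_rankShare (hm : 0 < m) (hx : x ∈ D.types) (hb : Measurable b) (e : ℝ) (r : ℕ) :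
    Integrable (fun y => rankShare m b i e (Function.update y i x) r) (posterior D n m i x) := by
  have := isProbabilityMeasure_posterior (n := n) (i := i) hm hx
  refine Integrable.of_bound (C := 1) ?_ (Eventually.of_forall fun y => ?_)
  · exact ((measurable_rankShare m hb i e r).comp measurable_update_left).aestronglyMeasurable
  · rw [Real.norm_of_nonneg (rankShare_nonneg _ _)]
    exact rankShare_le_one _ _

theorem le_rankProb (hm : 0 < m) (hx : x ∈ D.types) (hb : Measurable b) (e : ℝ) :
    (posterior D n m i x).real (othersIn i (b ⁻¹' Iio e)) ≤ rankProb D n m b i x e 1 := by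
  have := isProbabilityMeasure_posterior (n := n) (i := i) hm hx
  have hmeas := measurableSet_othersIn i (hb (measurableSet_Iio (a := e)))
  rw [← integral_indicator_one hmeas]
  refine integral_mono ((integrable_const 1).indicator hmeas)
    (integrable_rankShare hm hx hb e 1) fun y => ?_
  by_cases hy : y ∈ othersIn i (b ⁻¹' Iio e)
  · rw [indicator_of_mem hy]
    refine (rankShare_eq_one fun j hj => ?_).ge
    rw [Function.update_of_ne hj]
    exact hy j hj
  · rw [indicator_of_notMem hy]
    exact rankShare_nonneg _ _

/-- The share is at most `1` if all rivals are below `e`, at most `1 / 2` if the best of them ties,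
and `0` otherwise: the average of two indicators. The loss of one half at a tie is what later
excludes flat pieces. -/
theorem rankProb_le (hm : 2 ≤ m) (hx : x ∈ D.types) (hb : Monotone b) (e : ℝ) :
    rankProb D n m b i x e 1 ≤ ((posterior D n m i x).real (othersIn i (b ⁻¹' Iio e)) +
      (posterior D n m i x).real (othersIn i (b ⁻¹' Iic e))) / 2 := by
  have hm0 : 0 < m := two_pos.trans_le hm
  have := isProbabilityMeasure_posterior (n := n) (i := i) hm0 hx
  have hm1 := measurableSet_othersIn i (hb.measurable (measurableSet_Iio (a := e)))
  have hm2 := measurableSet_othersIn i (hb.measurable (measurableSet_Iic (a := e)))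
  rw [← integral_indicator_one hm1, ← integral_indicator_one hm2,
    ← integral_add ((integrable_const 1).indicator hm1) ((integrable_const 1).indicator hm2),
    ← integral_div]
  refine integral_mono (integrable_rankShare hm0 hx hb.measurable e 1)
    ((((integrable_const 1).indicator hm1).add ((integrable_const 1).indicator hm2)).div_const 2)
    fun y => ?_
  dsimp only
  have hsub : othersIn i (b ⁻¹' Iio e) ⊆ othersIn i (b ⁻¹' Iic e) :=
    othersIn_mono i (preimage_mono Iio_subset_Iic_self)
  by_cases hy : y ∈ othersIn i (b ⁻¹' Iio e)
  · rw [indicator_of_mem hy, indicator_of_mem (hsub hy)]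
    refine (rankShare_le_one _ _).trans (by norm_num)
  · rw [indicator_of_notMem hy]
    simp only [othersIn, mem_ofPred_eq, not_forall, mem_preimage, mem_Iio, not_lt] at hy
    obtain ⟨j, hj, hje⟩ := hy
    by_cases hy' : y ∈ othersIn i (b ⁻¹' Iic e)
    · rw [indicator_of_mem hy']
      refine (rankShare_le_half hm hb ⟨j, hj, ?_⟩).trans (by norm_num)
      rwa [Function.update_of_ne hj]
    · rw [indicator_of_notMem hy']
      simp only [othersIn, mem_ofPred_eq, not_forall, mem_preimage, mem_Iic, not_le] at hy'
      obtain ⟨l, hl, hle⟩ := hy'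
      refine (rankShare_eq_zero hm hb ⟨l, hl, ?_⟩).le.trans (by norm_num)
      rwa [Function.update_of_ne hl]

theorem rankProb_le_Iic (hm : 2 ≤ m) (hx : x ∈ D.types) (hb : Monotone b) (e : ℝ) :
    rankProb D n m b i x e 1 ≤ (posterior D n m i x).real (othersIn i (b ⁻¹' Iic e)) := by
  have := isProbabilityMeasure_posterior (n := n) (i := i) (two_pos.trans_le hm) hx
  have h1 := rankProb_le (n := n) (i := i) hm hx hb e
  have h2 : (posterior D n m i x).real (othersIn i (b ⁻¹' Iio e)) ≤
      (posterior D n m i x).real (othersIn i (b ⁻¹' Iic e)) :=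
    measureReal_mono (othersIn_mono i (preimage_mono Iio_subset_Iic_self))
  linarith

theorem rankProb_nonneg (e : ℝ) (r : ℕ) : 0 ≤ rankProb D n m b i x e r :=
  integral_nonneg fun _ => rankShare_nonneg _ _

theorem expectedUtility_winnerTakeAll (hm : 0 < m) (B : ℝ) (g : ℝ → ℝ) (e : ℝ) :
    expectedUtility D n m (winnerTakeAll B) g b i x e =
      B * rankProb D n m b i x e 1 - g e / x := by
  rw [expectedUtility, Finset.sum_eq_single 1]
  · simp [winnerTakeAll]
  · intro r _ hr
    simp [winnerTakeAll, hr]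
  · intro h
    exact absurd (Finset.mem_Icc.2 ⟨le_rfl, hm⟩) h

/-- The chance to win at the effort of an ability `z` when the effort function is injective. -/
theorem rankProb_apply (hm : 2 ≤ m) (hx : x ∈ D.types) (hb : Monotone b)
    (hs : StrictMonoOn b D.types) {z : ℝ} (hz : z ∈ D.types) :
    rankProb D n m b i x (b z) 1 = oddsBelow D n m i x z := by
  have hm0 : 0 < m := two_pos.trans_le hm
  have := isProbabilityMeasure_posterior (n := n) (i := i) hm0 hx
  refine le_antisymm ((rankProb_le_Iic hm hx hb _).trans ?_)
    (le_trans ?_ (le_rankProb hm0 hx hb.measurable _))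
  · refine measureReal_mono (othersIn_mono i fun t ht => ?_)
    by_contra! hzt
    obtain ⟨w, hw, hzw⟩ := D.exists_gt_mem_types hz
    -- Strictness is known only on `types`; capping `t` by `w` gives a point above `z` that is still
    -- a type.
    have h1 : b (min w t) ≤ b z := (hb (min_le_right _ _)).trans ht
    have h2 : z < min w t := lt_min hzw (not_le.1 hzt)
    exact h1.not_gt (hs hz (D.ordConnected_types.out hz hw ⟨h2.le, min_le_left _ _⟩) h2)
  · refine ENNReal.toReal_mono (measure_ne_top _ _) (measure_mono_ae ?_)
    filter_upwards [ae_posterior_mem_types (D := D), ae_posterior_ne z] with y hy hyz h j hj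
    exact hs (hy j) hz (lt_of_le_of_ne (h j hj) (hyz j))

end rankProb

/-! ### Expected maximum effort. -/

section maxEffort

variable {D : AbilityDistribution} {n m : ℕ} {b : ℝ → ℝ}

theorem maxEffort_le (hb : ∀ x, 0 ≤ b x) {U : ℝ} (hU : 0 ≤ U) (h : ∀ x ∈ D.types, b x ≤ U) :
    maxEffort D n m b ≤ U := by
  have hae : ∀ᵐ y ∂(D.profileLaw n), ∀ j, y j ∈ D.types := ae_all_iff.2 fun j =>
    (Measure.quasiMeasurePreserving_eval (fun _ : Fin n => D.law) j).ae
      (mem_ae_iff.2 D.law_compl_types)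
  calc maxEffort D n m b ≤ ∫ _, U ∂(D.profileLaw n) := by
        refine integral_mono_of_nonneg (Eventually.of_forall fun y => ?_) (integrable_const U) ?_
        · refine Real.iSup_nonneg fun i => ?_
          split_ifs
          exacts [hb _, le_rfl]
        · filter_upwards [hae] with y hy
          refine Real.iSup_le (fun i => ?_) hU
          split_ifs
          exacts [h _ (hy i), hU]
    _ = U := by simp

/-- The strongest contestant is always shortlisted, and with probability `1 - F(z) ^ n` she is above
`z`. The bound `U` serves integrability only. -/
theorem le_maxEffort (hm : 0 < m) (hbm : Monotone b) (hb : ∀ x, 0 ≤ b x) {U : ℝ} (hU : 0 ≤ U)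
    (h : ∀ x ∈ D.types, b x ≤ U) (z : ℝ) :
    b z * (1 - D.cdf z ^ n) ≤ maxEffort D n m b := by
  have hae : ∀ᵐ y ∂(D.profileLaw n), ∀ j, y j ∈ D.types := ae_all_iff.2 fun j =>
    (Measure.quasiMeasurePreserving_eval (fun _ : Fin n => D.law) j).ae
      (mem_ae_iff.2 D.law_compl_types)
  have hms : MeasurableSet {y : Fin n → ℝ | ∀ j, y j ≤ z} := by
    rw [ofPred_forall]
    exact MeasurableSet.iInter fun j => measurableSet_le (measurable_pi_apply j) measurable_const
  have hint : Integrable (fun y : Fin n → ℝ => ⨆ i, if i ∈ shortlist m y then b (y i) else 0)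
      (D.profileLaw n) := by
    refine Integrable.of_bound (C := U) (Measurable.iSup fun i => ?_).aestronglyMeasurable ?_
    · exact Measurable.ite (measurableSet_mem_shortlist m i)
        (hbm.measurable.comp (measurable_pi_apply i)) measurable_const
    · filter_upwards [hae] with y hy
      rw [Real.norm_of_nonneg]
      · refine Real.iSup_le (fun i => ?_) hU
        split_ifs
        exacts [h _ (hy i), hU]
      · refine Real.iSup_nonneg fun i => ?_
        split_ifs
        exacts [hb _, le_rfl]
  have hreal : (D.profileLaw n).real {y : Fin n → ℝ | ∀ j, y j ≤ z}ᶜ = 1 - D.cdf z ^ n := by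
    rw [probReal_compl_eq_one_sub hms, D.profileLaw_real_forall_le]
  rw [← hreal, mul_comm, ← smul_eq_mul, ← integral_indicator_const _ hms.compl]
  refine integral_mono ((integrable_const _).indicator hms.compl) hint fun y => ?_
  by_cases hy : y ∈ {y : Fin n → ℝ | ∀ j, y j ≤ z}ᶜ
  · rw [indicator_of_mem hy]
    simp only [mem_compl_iff, mem_ofPred_eq, not_forall, not_le] at hy
    obtain ⟨j, hj⟩ := hy
    obtain ⟨l, -, hl⟩ := Finset.univ.exists_max_image y ⟨j, Finset.mem_univ j⟩
    have hmem : l ∈ shortlist m y := by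
      simp only [shortlist, Finset.mem_filter, Finset.mem_univ, true_and]
      rwa [Finset.filter_eq_empty_iff.2 fun k _ => (hl k (Finset.mem_univ k)).not_gt,
        Finset.card_empty]
    refine le_ciSup_of_le (Set.finite_range _).bddAbove l ?_
    rw [if_pos hmem]
    exact hbm (hj.le.trans (hl j (Finset.mem_univ j)))
  · rw [indicator_of_notMem hy]
    refine Real.iSup_nonneg fun i => ?_
    split_ifs
    exacts [hb _, le_rfl]

end maxEffort

/-! ### Differentiability from increments and from compositions. -/

section calculus

/-- The deviation of `b` from `c x * F` is at most `(c z - c x) * (F z - F x)`, a product of `o(1)`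
and `O(z - x)`. -/
theorem hasDerivAt_of_increment_bounds {b c F : ℝ → ℝ} {f x : ℝ} (hF : HasDerivAt F f x)
    (hc : ContinuousAt c x)
    (h : ∀ᶠ z in 𝓝 x, c x * (F z - F x) ≤ b z - b x ∧ b z - b x ≤ c z * (F z - F x)) :
    HasDerivAt b (c x * f) x := by
  have h1 : (fun z => b z - b x - c x * (F z - F x)) =O[𝓝 x]
      fun z => (c z - c x) * (F z - F x) := by
    refine Asymptotics.IsBigO.of_bound 1 (h.mono fun z hz => ?_)
    rw [one_mul, Real.norm_of_nonneg (by linarith), Real.norm_of_nonneg (by linarith)]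
    linarith
  have h2 : (fun z => (c z - c x) * (F z - F x)) =o[𝓝 x] fun z => (1 : ℝ) * (z - x) := by
    refine Asymptotics.IsLittleO.mul_isBigO ?_ hF.isBigO_sub
    rw [Asymptotics.isLittleO_one_iff]
    simpa using hc.sub_const (c x)
  have h3 := h1.trans_isLittleO h2
  simp only [one_mul] at h3
  have h4 := (hasDerivAt_iff_isLittleO.1 hF).const_mul_left (c x)
  rw [hasDerivAt_iff_isLittleO]
  refine (h3.add h4).congr_left fun z => ?_
  simp only [smul_eq_mul]
  ring

/-- If `W ∘ b` and `W` are differentiable and `W' ≠ 0`, then `b` is differentiable. -/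
theorem hasDerivAt_of_comp_left {b W q : ℝ → ℝ} {w d x : ℝ} (hb : ContinuousAt b x)
    (hW : HasDerivAt W w (b x)) (hw : w ≠ 0) (hq : HasDerivAt q d x)
    (h : ∀ᶠ z in 𝓝 x, W (b z) = q z) : HasDerivAt b (d / w) x := by
  rw [hasDerivAt_iff_tendsto_slope] at hq ⊢
  have h1 : Tendsto (fun z => dslope W (b x) (b z)) (𝓝[≠] x) (𝓝 w) := by
    have := (continuousAt_dslope_same.2 hW.differentiableAt).tendsto.comp hb.tendsto
    rw [dslope_same, hW.deriv] at this
    exact this.mono_left nhdsWithin_le_nhds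
  refine (hq.div h1 hw).congr' ?_
  filter_upwards [h1.eventually_ne hw, h.filter_mono nhdsWithin_le_nhds] with z hz hWz
  rw [Pi.div_apply, div_eq_iff hz, slope_def_field, slope_def_field, ← hWz, ← h.self_of_nhds,
    ← sub_smul_dslope, smul_eq_mul]
  ring

/-- If `b` and `W ∘ b` are differentiable and `b' ≠ 0`, then `W` is differentiable. -/
theorem hasDerivAt_of_comp_right {b W q : ℝ → ℝ} {b' d x : ℝ} (hb : HasStrictDerivAt b b' x)
    (hb' : b' ≠ 0) (hq : HasDerivAt q d x) (h : ∀ᶠ z in 𝓝 x, W (b z) = q z) :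
    HasDerivAt W (d / b') (b x) := by
  have hx : hb.localInverse b b' x hb' (b x) = x := (hb.eventually_left_inverse hb').self_of_nhds
  have hg := (hb.to_localInverse hb').hasDerivAt
  have ht : Tendsto (hb.localInverse b b' x hb') (𝓝 (b x)) (𝓝 x) := by
    simpa only [hx] using hg.continuousAt.tendsto
  rw [← hx] at hq
  refine ((hq.comp (b x) hg).congr_of_eventuallyEq ?_)
  filter_upwards [hb.eventually_right_inverse hb', ht.eventually h] with e he hWe
  rw [Function.comp_apply, ← hWe, he]

end calculus

/-! ### Necessary conditions for equilibrium. -/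

/-- The antiderivative of `rivalRate`. -/
noncomputable def rivalPotential (n : ℕ) (u : ℝ) : ℝ := ∫ s in (0 : ℝ)..u, rivalRate n s

theorem rivalPotential_zero (n : ℕ) : rivalPotential n 0 = 0 := intervalIntegral.integral_same

theorem hasDerivAt_rivalPotential {n : ℕ} (hn : 2 ≤ n) (u : ℝ) :
    HasDerivAt (rivalPotential n) (rivalRate n u) u :=
  (continuous_rivalRate hn).integral_hasStrictDerivAt 0 u |>.hasDerivAt

theorem strictMono_rivalPotential {n : ℕ} (hn : 2 ≤ n) : StrictMono (rivalPotential n) :=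
  strictMono_of_hasDerivAt_pos (hasDerivAt_rivalPotential hn) (rivalRate_pos hn)

/-- The increments of the effort function `b` are those of a Stieltjes integral `∫ K x dΦ x`. -/
def HasBidIncrements (D : AbilityDistribution) (K : ℝ) (Φ b : ℝ → ℝ) : Prop :=
  ∀ x ∈ D.types, ∀ y ∈ D.types, x ≤ y →
    K * x * (Φ y - Φ x) ≤ b y - b x ∧ b y - b x ≤ K * y * (Φ y - Φ x)

section necessary

variable {D : AbilityDistribution} {n m : ℕ} {b : ℝ → ℝ} {x k B : ℝ}

/-- By Cauchy's mean value theorem, the increment of `b` is `K c` times that of `Φ` for some `c`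
between `x` and `y`. -/
theorem hasBidIncrements_of_hasDerivAt (hn : 2 ≤ n) {K : ℝ} (hK : 0 < K)
    (h : ∀ x ∈ D.types, HasDerivAt b (K * x * rivalRate n (D.cdf x) * D.density x) x) :
    HasBidIncrements D K (fun x => rivalPotential n (D.cdf x)) b := by
  intro x hx y hy hxy
  rcases hxy.eq_or_lt with rfl | hlt
  · simp
  have hsub : Icc x y ⊆ D.types := D.ordConnected_types.out hx hy
  have hΦ : ∀ z ∈ D.types, HasDerivAt (fun x => rivalPotential n (D.cdf x))
      (rivalRate n (D.cdf z) * D.density z) z := fun z hz =>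
    (hasDerivAt_rivalPotential hn _).comp z (D.hasDerivAt_cdf hz)
  obtain ⟨c, hc, heq⟩ := exists_ratio_hasDerivAt_eq_ratio_slope b _ hlt
    (fun z hz => (h z (hsub hz)).continuousAt.continuousWithinAt)
    (fun z hz => h z (hsub (Ioo_subset_Icc_self hz))) _ _
    (fun z hz => (hΦ z (hsub hz)).continuousAt.continuousWithinAt)
    (fun z hz => hΦ z (hsub (Ioo_subset_Icc_self hz)))
  have hc' := hsub (Ioo_subset_Icc_self hc)
  have hpos : 0 < rivalRate n (D.cdf c) * D.density c := mul_pos (rivalRate_pos hn _) hc'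
  have key : b y - b x = K * c * (rivalPotential n (D.cdf y) - rivalPotential n (D.cdf x)) := by
    refine mul_right_cancel₀ hpos.ne' ?_
    linear_combination -heq
  have hmono : 0 ≤ rivalPotential n (D.cdf y) - rivalPotential n (D.cdf x) :=
    sub_nonneg.2 ((strictMono_rivalPotential hn).monotone (D.monotone_cdf hxy))
  rw [key]
  exact ⟨mul_le_mul_of_nonneg_right (mul_le_mul_of_nonneg_left hc.1.le hK.le) hmono,
    mul_le_mul_of_nonneg_right (mul_le_mul_of_nonneg_left hc.2.le hK.le) hmono⟩

/-- If `b` is flat on `[z, x]`, all rivals lie there with positive probability, and any higher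
effort wins at least half of this tie mass. -/
theorem exists_rankProb_jump (hn : 2 ≤ n) (hm : 2 ≤ m) (hb : Monotone b) (i : Fin n) {z : ℝ}
    (hz : z ∈ D.types) (hx : x ∈ D.types) (hzx : z < x) (heq : b z = b x) :
    ∃ δ > 0, ∀ e > b x, rankProb D n m b i x (b x) 1 + δ ≤ rankProb D n m b i x e 1 := by
  have hm0 : 0 < m := two_pos.trans_le hm
  have := isProbabilityMeasure_posterior (n := n) (i := i) hm0 hx
  refine ⟨(posterior D n m i x).real (othersIn i (Ioc z x)) / 2,
    half_pos (posterior_real_othersIn_Ioc_pos hm0 hz hx hzx), fun e he => ?_⟩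
  have h1 := rankProb_le (n := n) (i := i) hm hx hb (b x)
  have h2 := le_rankProb (n := n) (i := i) hm0 hx hb.measurable e
  have h3 : (posterior D n m i x).real (othersIn i (b ⁻¹' Iic (b x))) ≤
      (posterior D n m i x).real (othersIn i (b ⁻¹' Iio e)) :=
    measureReal_mono (othersIn_mono i fun t (ht : b t ≤ b x) => ht.trans_lt he)
  have h4 : (posterior D n m i x).real (othersIn i (Ioc z x)) +
      (posterior D n m i x).real (othersIn i (b ⁻¹' Iio (b x))) ≤
      (posterior D n m i x).real (othersIn i (b ⁻¹' Iic (b x))) := by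
    rw [← measureReal_union]
    · refine measureReal_mono (union_subset (othersIn_mono i fun t ht => hb ht.2)
        (othersIn_mono i (preimage_mono Iio_subset_Iic_self)))
    · refine Set.disjoint_left.2 fun y hy hy' => ?_
      have : Nontrivial (Fin n) := Fin.nontrivial_iff_two_le.2 hn
      obtain ⟨j, hj⟩ := exists_ne i
      have h5 : b (y j) < b x := hy' j hj
      exact (heq ▸ hb (hy j hj).1.le : b x ≤ b (y j)).not_gt h5
    · exact measurableSet_othersIn i (hb.measurable measurableSet_Iio)
  linarith

theorem IsSBNE.strictMonoOn (hk : 0 < k) (hB : 0 < B) (hn : 2 ≤ n) (hm : 2 ≤ m)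
    (h : IsSBNE D n m (winnerTakeAll B) (linearCost k) b) : StrictMonoOn b D.types := by
  intro z hz x hx hzx
  refine (h.monotone hzx.le).lt_of_ne fun heq => ?_
  let i : Fin n := ⟨0, by omega⟩
  obtain ⟨δ, hδ, hj⟩ := exists_rankProb_jump hn hm h.monotone i hz hx hzx heq
  have hx0 := D.pos_of_mem_types hx
  -- This extra effort costs `B * δ / 2`, half of what the jump gains.
  have hη : 0 < B * δ * x / (2 * k) := by positivity
  have h1 := hj (b x + B * δ * x / (2 * k)) (by linarith)
  have h2 := h.optimal i x hx (b x + B * δ * x / (2 * k)) (by linarith [h.nonneg x])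
  rw [expectedUtility_winnerTakeAll (by omega), expectedUtility_winnerTakeAll (by omega)] at h2
  have h3 : linearCost k (b x + B * δ * x / (2 * k)) / x = linearCost k (b x) / x + B * δ / 2 := by
    unfold linearCost; field_simp
  have h4 := mul_le_mul_of_nonneg_left h1 hB.le
  have h5 := mul_pos hB hδ
  linarith

theorem IsFirstOrderSBNE.strictMonoOn (hB : 0 < B) (hn : 2 ≤ n) (hm : 2 ≤ m)
    (h : IsFirstOrderSBNE D n m (winnerTakeAll B) (linearCost k) b) :
    StrictMonoOn b D.types := by
  intro z hz x hx hzx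
  refine (h.monotone hzx.le).lt_of_ne fun heq => ?_
  let i : Fin n := ⟨0, by omega⟩
  obtain ⟨δ, hδ, hj⟩ := exists_rankProb_jump hn hm h.monotone i hz hx hzx heq
  have h1 := (h.critical i x hx).continuousAt.tendsto
  have h2 : Tendsto (fun e => expectedUtility D n m (winnerTakeAll B) (linearCost k) b i x (b x) +
      B * δ - (linearCost k e / x - linearCost k (b x) / x)) (𝓝 (b x))
      (𝓝 (expectedUtility D n m (winnerTakeAll B) (linearCost k) b i x (b x) +
      B * δ - (linearCost k (b x) / x - linearCost k (b x) / x))) := by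
    refine Continuous.tendsto ?_ _
    unfold linearCost; fun_prop
  have h3 := le_of_tendsto_of_tendsto (h2.mono_left (nhdsWithin_le_nhds (s := Ioi (b x))))
    (h1.mono_left nhdsWithin_le_nhds) (by
      filter_upwards [self_mem_nhdsWithin] with e he
      rw [expectedUtility_winnerTakeAll (by omega), expectedUtility_winnerTakeAll (by omega)]
      have := mul_le_mul_of_nonneg_left (hj e he) hB.le
      linarith)
  have := mul_pos hB hδ
  linarith

/-- The incentive constraint against imitating another ability. -/
theorem IsSBNE.oddsBelow_sub_le (hk : 0 < k) (hB : 0 < B) (hn : 2 ≤ n) (hm : 2 ≤ m)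
    (h : IsSBNE D n m (winnerTakeAll B) (linearCost k) b) (i : Fin n) (hx : x ∈ D.types)
    {z : ℝ} (hz : z ∈ D.types) :
    B / k * x * (oddsBelow D n m i x z - oddsBelow D n m i x x) ≤ b z - b x := by
  have hs := h.strictMonoOn hk hB hn hm
  have h1 := h.optimal i x hx (b z) (h.nonneg z)
  rw [expectedUtility_winnerTakeAll (by omega), expectedUtility_winnerTakeAll (by omega),
    rankProb_apply hm hx h.monotone hs hz, rankProb_apply hm hx h.monotone hs hx] at h1
  have hx0 := D.pos_of_mem_types hx
  have h2 : B * (oddsBelow D n m i x z - oddsBelow D n m i x x) ≤ k * (b z - b x) / x := by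
    unfold linearCost at h1
    rw [mul_sub, mul_sub, sub_div]; linarith
  rw [le_div_iff₀ hx0] at h2
  rw [div_mul_eq_mul_div, div_mul_eq_mul_div, div_le_iff₀ hk]
  linarith

/-- Zero effort guarantees non-negative utility, so the equilibrium cost cannot exceed the expected
prize. -/
theorem IsSBNE.le_oddsBelow (hk : 0 < k) (hB : 0 < B) (hn : 2 ≤ n) (hm : 2 ≤ m)
    (h : IsSBNE D n m (winnerTakeAll B) (linearCost k) b) (i : Fin n) (hx : x ∈ D.types) :
    b x ≤ B / k * x * oddsBelow D n m i x x := by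
  have hs := h.strictMonoOn hk hB hn hm
  have h1 := h.optimal i x hx 0 le_rfl
  rw [expectedUtility_winnerTakeAll (by omega), expectedUtility_winnerTakeAll (by omega),
    rankProb_apply hm hx h.monotone hs hx] at h1
  have hx0 := D.pos_of_mem_types hx
  have h2 : k * b x / x ≤ B * oddsBelow D n m i x x := by
    unfold linearCost at h1
    have := mul_nonneg hB.le (rankProb_nonneg (D := D) (m := m) (b := b) (i := i) (x := x) 0 1)
    simp only [mul_zero, zero_div, sub_zero] at h1
    linarith
  rw [div_le_iff₀ hx0] at h2
  rw [div_mul_eq_mul_div, div_mul_eq_mul_div, le_div_iff₀ hk]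
  linarith

theorem IsSBNE.hasBidIncrements_self (hk : 0 < k) (hB : 0 < B) (hn : 2 ≤ n)
    (h : IsSBNE D n n (winnerTakeAll B) (linearCost k) b) :
    HasBidIncrements D (B / k) (fun x => D.cdf x ^ (n - 1)) b := by
  intro x hx y hy _
  let i : Fin n := ⟨0, by omega⟩
  have h1 := h.oddsBelow_sub_le hk hB hn hn i hx hy
  have h2 := h.oddsBelow_sub_le hk hB hn hn i hy hx
  simp only [oddsBelow_self] at h1 h2
  constructor <;> linarith

/-- The posterior now depends on the own ability, but the tangent bound on the odds turns the
constraints of `x` against `z` and of `z` against `x` into a squeeze by increments of `F`. -/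
theorem IsSBNE.hasDerivAt_two (hk : 0 < k) (hB : 0 < B) (hn : 2 ≤ n)
    (h : IsSBNE D n 2 (winnerTakeAll B) (linearCost k) b) (hx : x ∈ D.types) :
    HasDerivAt b (B / k * x * rivalRate n (D.cdf x) * D.density x) x := by
  let i : Fin n := ⟨0, by omega⟩
  have key : ∀ y ∈ D.types, ∀ z ∈ D.types,
      B / k * y * rivalRate n (D.cdf y) * (D.cdf z - D.cdf y) ≤ b z - b y := fun y hy z hz => by
    refine le_trans ?_ (h.oddsBelow_sub_le hk hB hn le_rfl i hy hz)
    rw [mul_assoc _ (rivalRate _ _)]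
    have := D.pos_of_mem_types hy
    exact mul_le_mul_of_nonneg_left (rivalRate_mul_le_oddsBelow_sub hn hy z) (by positivity)
  refine hasDerivAt_of_increment_bounds (c := fun y => B / k * y * rivalRate n (D.cdf y))
    (D.hasDerivAt_cdf hx) ?_ ?_
  · have := (continuous_rivalRate hn).comp D.continuous_cdf
    exact ((continuous_const.mul continuous_id).mul this).continuousAt
  · filter_upwards [D.isOpen_types.mem_nhds hx] with z hz
    have h1 := key x hx z hz
    have h2 := key z hz x hx
    constructor <;> linarith

/-- In a gap of efforts next to `b x`, moving away from `b x` changes the winning probability in no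
way that offsets the cost: the one-sided slope of utility would be at most `-k / x`, not `0`. -/
theorem IsFirstOrderSBNE.continuousAt (hk : 0 < k) (hB : 0 < B) (hn : 2 ≤ n) (hm : 2 ≤ m)
    (h : IsFirstOrderSBNE D n m (winnerTakeAll B) (linearCost k) b) (hx : x ∈ D.types) :
    ContinuousAt b x := by
  let i : Fin n := ⟨0, by omega⟩
  have hm0 : 0 < m := by omega
  have := isProbabilityMeasure_posterior (n := n) (i := i) hm0 hx
  have hs := h.strictMonoOn hB hn hm
  have hx0 := D.pos_of_mem_types hx
  have hkx : 0 < k / x := by positivity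
  have hW := rankProb_apply (i := i) hm hx h.monotone hs hx
  obtain ⟨hleft, hright⟩ := hasDerivAt_iff_tendsto_slope_left_right.1 (h.critical i x hx)
  have hl : ∀ ε > 0, ∃ z < x, b x - ε < b z := by
    intro ε hε
    by_contra! hcon
    have : (0 : ℝ) ≤ -(k / x) := by
      refine le_of_tendsto hleft ?_
      filter_upwards [Ioo_mem_nhdsLT (sub_lt_self (b x) hε)] with e he
      have h1 : oddsBelow D n m i x x ≤ rankProb D n m b i x e 1 := by
        refine le_trans (ENNReal.toReal_mono (measure_ne_top _ _) (measure_mono_ae ?_))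
          (le_rankProb hm0 hx h.monotone.measurable e)
        filter_upwards [ae_posterior_ne x] with y hyx hy j hj
        exact (hcon _ (lt_of_le_of_ne (hy j hj) (hyx j))).trans_lt he.1
      rw [slope_def_field, div_le_iff_of_neg (by linarith [he.2]),
        expectedUtility_winnerTakeAll hm0, expectedUtility_winnerTakeAll hm0, hW]
      have h2 := mul_le_mul_of_nonneg_left h1 hB.le
      have h3 : linearCost k e / x - linearCost k (b x) / x = k / x * (e - b x) := by
        unfold linearCost; ring
      linarith
    linarith
  have hr : ∀ ε > 0, ∃ z > x, b z < b x + ε := by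
    intro ε hε
    by_contra! hcon
    have : (0 : ℝ) ≤ -(k / x) := by
      refine le_of_tendsto hright ?_
      filter_upwards [Ioo_mem_nhdsGT (lt_add_of_pos_right (b x) hε)] with e he
      have h1 : rankProb D n m b i x e 1 ≤ oddsBelow D n m i x x := by
        refine (rankProb_le_Iic hm hx h.monotone e).trans
          (measureReal_mono (othersIn_mono i fun t (ht : b t ≤ e) => ?_))
        by_contra htx
        linarith [hcon t (not_le.1 htx), he.2]
      rw [slope_def_field, div_le_iff₀ (by linarith [he.1]),
        expectedUtility_winnerTakeAll hm0, expectedUtility_winnerTakeAll hm0, hW]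
      have h2 := mul_le_mul_of_nonneg_left h1 hB.le
      have h3 : linearCost k e / x - linearCost k (b x) / x = k / x * (e - b x) := by
        unfold linearCost; ring
      linarith
    linarith
  rw [Metric.continuousAt_iff']
  intro ε hε
  obtain ⟨z, hz, hbz⟩ := hl ε hε
  obtain ⟨w, hw, hbw⟩ := hr ε hε
  filter_upwards [Ioo_mem_nhds hz hw] with t ht
  rw [Real.dist_eq, abs_lt]
  constructor <;> linarith [h.monotone ht.1.le, h.monotone ht.2.le]

/-- Criticality gives the winning probability the slope `k / (x * B)` at `b x`. Its composition with
`b` is the odds, with known derivative, so the chain rule is solved for `b'`. -/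
theorem IsFirstOrderSBNE.hasDerivAt_two (hk : 0 < k) (hB : 0 < B) (hn : 2 ≤ n)
    (h : IsFirstOrderSBNE D n 2 (winnerTakeAll B) (linearCost k) b) (hx : x ∈ D.types) :
    HasDerivAt b (B / k * x * rivalRate n (D.cdf x) * D.density x) x := by
  let i : Fin n := ⟨0, by omega⟩
  have hs := h.strictMonoOn hB hn le_rfl
  have hx0 := D.pos_of_mem_types hx
  have hW : HasDerivAt (fun e => rankProb D n 2 b i x e 1) (k / (x * B)) (b x) := by
    have h1 := ((h.critical i x hx).add
      (((hasDerivAt_id (b x)).const_mul k).div_const x)).div_const B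
    refine (h1.congr_deriv (by field_simp; ring)).congr_of_eventuallyEq
      (Eventually.of_forall fun e => ?_)
    simp only [Pi.add_apply]
    rw [expectedUtility_winnerTakeAll two_pos, linearCost, id]
    field_simp
    ring
  refine (hasDerivAt_of_comp_left (h.continuousAt hk hB hn le_rfl hx) hW (by positivity)
    (hasDerivAt_oddsBelow_two (i := i) hn hx) ?_).congr_deriv (by field_simp)
  filter_upwards [D.isOpen_types.mem_nhds hx] with z hz
  exact rankProb_apply le_rfl hx h.monotone hs hz

theorem IsSBNE.tendsto_bottom_two (hk : 0 < k) (hB : 0 < B) (hn : 2 ≤ n)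
    (h : IsSBNE D n 2 (winnerTakeAll B) (linearCost k) b) :
    Tendsto b (𝓝[>] (sInf D.types)) (𝓝 0) := by
  let i : Fin n := ⟨0, by omega⟩
  have h1 : Tendsto (fun x => B / k * x * (D.cdf x * rivalRate n (D.cdf x) / (n - 1)))
      (𝓝[>] (sInf D.types))
      (𝓝 (B / k * sInf D.types * (0 * rivalRate n 0 / (n - 1)))) := by
    have hid : Tendsto (fun x : ℝ => x) (𝓝[>] (sInf D.types)) (𝓝 (sInf D.types)) :=
      tendsto_id.mono_left nhdsWithin_le_nhds
    exact (hid.const_mul _).mul ((D.tendsto_cdf_bottom.mul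
      (((continuous_rivalRate hn).tendsto 0).comp D.tendsto_cdf_bottom)).div_const _)
  rw [zero_mul, zero_div, mul_zero] at h1
  refine tendsto_of_tendsto_of_tendsto_of_le_of_le' tendsto_const_nhds h1
    (Eventually.of_forall h.nonneg) ?_
  filter_upwards [D.eventually_mem_types] with x hx
  rw [← oddsBelow_two_self (i := i) hn hx]
  exact h.le_oddsBelow hk hB hn le_rfl i hx

end necessary

/-! ### The candidate effort function and existence. -/

/-- The Stieltjes integral `∫ t dΦ t` over `(0, x]`, integrated by parts. -/
noncomputable def bidIntegral (Φ : ℝ → ℝ) (x : ℝ) : ℝ := x * Φ x - ∫ t in (0 : ℝ)..x, Φ t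

section bidIntegral

variable {Φ : ℝ → ℝ} {x y : ℝ}

theorem bidIntegral_sub (hΦ : Continuous Φ) (x y : ℝ) :
    bidIntegral Φ y - bidIntegral Φ x = y * Φ y - x * Φ x - ∫ t in x..y, Φ t := by
  have := intervalIntegral.integral_add_adjacent_intervals
    (hΦ.intervalIntegrable (μ := volume) 0 x) (hΦ.intervalIntegrable x y)
  rw [bidIntegral, bidIntegral, ← this]
  ring

theorem le_bidIntegral_sub (hΦ : Continuous Φ) (hm : Monotone Φ) (hxy : x ≤ y) :
    x * (Φ y - Φ x) ≤ bidIntegral Φ y - bidIntegral Φ x := by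
  have : ∫ t in x..y, Φ t ≤ ∫ _ in x..y, Φ y := intervalIntegral.integral_mono_on hxy
    (hΦ.intervalIntegrable _ _) (by simp) fun t ht => hm ht.2
  rw [intervalIntegral.integral_const, smul_eq_mul] at this
  rw [bidIntegral_sub hΦ]
  linarith

theorem bidIntegral_sub_le (hΦ : Continuous Φ) (hm : Monotone Φ) (hxy : x ≤ y) :
    bidIntegral Φ y - bidIntegral Φ x ≤ y * (Φ y - Φ x) := by
  have : ∫ _ in x..y, Φ x ≤ ∫ t in x..y, Φ t := intervalIntegral.integral_mono_on hxy
    (by simp) (hΦ.intervalIntegrable _ _) fun t ht => hm ht.1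
  rw [intervalIntegral.integral_const, smul_eq_mul] at this
  rw [bidIntegral_sub hΦ]
  linarith

theorem bidIntegral_of_nonpos (h0 : ∀ t ≤ 0, Φ t = 0) (hx : x ≤ 0) : bidIntegral Φ x = 0 := by
  rw [bidIntegral, h0 x hx, intervalIntegral.integral_congr (g := fun _ => 0)]
  · simp
  · intro t ht
    rw [uIcc_of_ge hx] at ht
    exact h0 t ht.2

theorem continuous_bidIntegral (hΦ : Continuous Φ) : Continuous (bidIntegral Φ) :=
  (continuous_id.mul hΦ).sub
    (intervalIntegral.continuous_primitive (fun _ _ => hΦ.intervalIntegrable _ _) 0)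

theorem monotone_bidIntegral (hΦ : Continuous Φ) (hm : Monotone Φ) (h0 : ∀ t ≤ 0, Φ t = 0) :
    Monotone (bidIntegral Φ) := by
  have key : ∀ a b : ℝ, 0 ≤ a → a ≤ b → bidIntegral Φ a ≤ bidIntegral Φ b := fun a b ha hab => by
    have := le_bidIntegral_sub hΦ hm hab
    have := mul_nonneg ha (sub_nonneg.2 (hm hab))
    linarith
  intro x y hxy
  rcases le_total 0 x with hx | hx
  · exact key x y hx hxy
  · rw [bidIntegral_of_nonpos h0 hx]
    rcases le_total 0 y with hy | hy
    · rw [← bidIntegral_of_nonpos h0 (le_refl 0)]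
      exact key 0 y le_rfl hy
    · rw [bidIntegral_of_nonpos h0 hy]

theorem bidIntegral_nonneg (hΦ : Continuous Φ) (hm : Monotone Φ) (h0 : ∀ t ≤ 0, Φ t = 0) (x : ℝ) :
    0 ≤ bidIntegral Φ x := by
  rw [← bidIntegral_of_nonpos h0 (min_le_right x 0)]
  exact monotone_bidIntegral hΦ hm h0 (min_le_left x 0)

/-- This is incentive compatibility: imitating `y` never pays for ability `x`, in either direction.
-/
theorem mul_sub_le_bidIntegral_sub (hΦ : Continuous Φ) (hm : Monotone Φ) (x y : ℝ) :
    x * (Φ y - Φ x) ≤ bidIntegral Φ y - bidIntegral Φ x := by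
  rcases le_total x y with h | h
  · exact le_bidIntegral_sub hΦ hm h
  · linarith [bidIntegral_sub_le hΦ hm h]

end bidIntegral

section existence

variable {D : AbilityDistribution} {n : ℕ} {k B : ℝ}

theorem strictMonoOn_mul_bidIntegral {Φ : ℝ → ℝ} {K : ℝ} (hK : 0 < K) (hΦ : Continuous Φ)
    (hm : Monotone Φ) (hs : StrictMonoOn Φ D.types) :
    StrictMonoOn (fun x => K * bidIntegral Φ x) D.types := by
  intro x hx y hy hxy
  have h1 := le_bidIntegral_sub hΦ hm hxy.le
  have h2 := mul_pos (D.pos_of_mem_types hx) (sub_pos.2 (hs hx hy hxy))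
  exact mul_lt_mul_of_pos_left (by linarith) hK

theorem exists_isSBNE (hk : 0 < k) (hB : 0 < B) (hn : 2 ≤ n) {T : ℝ}
    (hT : ∀ x ∈ D.types, x ≤ T) :
    ∃ b : ℝ → ℝ, IsSBNE D n n (winnerTakeAll B) (linearCost k) b := by
  set G : ℝ → ℝ := fun x => D.cdf x ^ (n - 1) with hG
  have hc : Continuous G := D.continuous_cdf.pow _
  have hm : Monotone G := fun x y h => pow_le_pow_left₀ (D.cdf_nonneg x) (D.monotone_cdf h) _
  have h0 : ∀ t ≤ 0, G t = 0 := fun t ht => by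
    simp only [hG, D.cdf_nonpos ht]
    exact zero_pow (by omega)
  have hs : StrictMonoOn G D.types := fun x hx y hy h =>
    pow_lt_pow_left₀ (D.strictMonoOn_cdf hx hy h) (D.cdf_nonneg x) (by omega)
  have hK : 0 < B / k := div_pos hB hk
  have hbm : Monotone fun x => B / k * bidIntegral G x := fun x y h =>
    mul_le_mul_of_nonneg_left (monotone_bidIntegral hc hm h0 h) hK.le
  have hbs := strictMonoOn_mul_bidIntegral (D := D) hK hc hm hs
  have hT0 : 0 ≤ T := by
    obtain ⟨x, hx⟩ := D.types_nonempty
    exact (D.pos_of_mem_types hx).le.trans (hT x hx)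
  refine ⟨fun x => B / k * bidIntegral G x, hbm,
    fun x => mul_nonneg hK.le (bidIntegral_nonneg hc hm h0 x), fun i x hx e he => ?_⟩
  have := isProbabilityMeasure_posterior (n := n) (m := n) (i := i) (by omega) hx
  rw [expectedUtility_winnerTakeAll (by omega), expectedUtility_winnerTakeAll (by omega),
    rankProb_apply hn hx hbm hbs hx, oddsBelow_self]
  have hcomp : IsCompact {z ∈ Icc 0 T | B / k * bidIntegral G z ≤ e} :=
    isCompact_Icc.inter_right
      (isClosed_le (continuous_const.mul (continuous_bidIntegral hc)) continuous_const)
  -- The effort `e` is replaced by that of the highest `z` in `[0, T]` affordable with it: this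
  -- costs no more and wins at least as often, so only imitations need to be excluded.
  obtain ⟨z, ⟨-, hze⟩, hz⟩ := hcomp.exists_isGreatest ⟨0, ⟨le_rfl, hT0⟩, by
    rwa [bidIntegral_of_nonpos h0 le_rfl, mul_zero]⟩
  have hW : rankProb D n n (fun x => B / k * bidIntegral G x) i x e 1 ≤ G z := by
    refine (rankProb_le_Iic hn hx hbm e).trans ?_
    have : G z = (posterior D n n i x).real (othersIn i (Iic z)) := (oddsBelow_self z).symm
    rw [this]
    refine ENNReal.toReal_mono (measure_ne_top _ _) (measure_mono_ae ?_)
    filter_upwards [ae_posterior_mem_types (D := D)] with y hy h j hj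
    exact hz ⟨⟨(D.pos_of_mem_types (hy j)).le, hT _ (hy j)⟩, h j hj⟩
  have hx0 := D.pos_of_mem_types hx
  have h1 := mul_sub_le_bidIntegral_sub hc hm x z
  have h2 : linearCost k (B / k * bidIntegral G z) / x - linearCost k (B / k * bidIntegral G x) / x
      = B * (bidIntegral G z - bidIntegral G x) / x := by
    unfold linearCost; field_simp
  have h3 : B * (G z - G x) ≤ B * (bidIntegral G z - bidIntegral G x) / x := by
    rw [le_div_iff₀ hx0]
    have := mul_le_mul_of_nonneg_left h1 hB.le
    linarith
  have h4 : linearCost k (B / k * bidIntegral G z) / x ≤ linearCost k e / x :=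
    div_le_div_of_nonneg_right (mul_le_mul_of_nonneg_left hze hk.le) hx0.le
  have h5 := mul_le_mul_of_nonneg_left hW hB.le
  change _ ≤ B * G x - _
  linarith

theorem exists_isFirstOrderSBNE (hk : 0 < k) (hB : 0 < B) (hn : 2 ≤ n) :
    ∃ b : ℝ → ℝ, IsFirstOrderSBNE D n 2 (winnerTakeAll B) (linearCost k) b := by
  set Φ : ℝ → ℝ := fun x => rivalPotential n (D.cdf x) with hΦ
  have hpot : Continuous (rivalPotential n) :=
    continuous_iff_continuousAt.2 fun u => (hasDerivAt_rivalPotential hn u).continuousAt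
  have hc : Continuous Φ := hpot.comp D.continuous_cdf
  have hm : Monotone Φ := (strictMono_rivalPotential hn).monotone.comp D.monotone_cdf
  have h0 : ∀ t ≤ 0, Φ t = 0 := fun t ht => by
    simp only [hΦ, D.cdf_nonpos ht, rivalPotential_zero]
  have hs : StrictMonoOn Φ D.types := (strictMono_rivalPotential hn).comp_strictMonoOn
    D.strictMonoOn_cdf
  have hK : 0 < B / k := div_pos hB hk
  have hbm : Monotone fun x => B / k * bidIntegral Φ x := fun x y h =>
    mul_le_mul_of_nonneg_left (monotone_bidIntegral hc hm h0 h) hK.le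
  have hb0 : ∀ x, 0 ≤ B / k * bidIntegral Φ x := fun x =>
    mul_nonneg hK.le (bidIntegral_nonneg hc hm h0 x)
  have hbs := strictMonoOn_mul_bidIntegral (D := D) hK hc hm hs
  have hderiv : ∀ x ∈ D.types, HasDerivAt (fun x => B / k * bidIntegral Φ x)
      (B / k * x * (rivalRate n (D.cdf x) * D.density x)) x := fun x hx => by
    have hΦx : HasDerivAt Φ (rivalRate n (D.cdf x) * D.density x) x :=
      (hasDerivAt_rivalPotential hn _).comp x (D.hasDerivAt_cdf hx)
    refine hasDerivAt_of_increment_bounds (c := fun y => B / k * y) hΦx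
      (continuous_const.mul continuous_id).continuousAt (Eventually.of_forall fun z => ?_)
    have h1 := mul_le_mul_of_nonneg_left (mul_sub_le_bidIntegral_sub hc hm x z) hK.le
    have h2 := mul_le_mul_of_nonneg_left (mul_sub_le_bidIntegral_sub hc hm z x) hK.le
    constructor <;> linarith
  refine ⟨fun x => B / k * bidIntegral Φ x, hbm, hb0, ?_, fun i x hx => ?_⟩
  · have h1 : Tendsto (fun x => B / k * (x * Φ x)) (𝓝[>] (sInf D.types))
        (𝓝 (B / k * (sInf D.types * Φ (sInf D.types)))) :=
      ((continuous_const.mul (continuous_id.mul hc)).tendsto _).mono_left nhdsWithin_le_nhds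
    rw [show Φ (sInf D.types) = 0 by simp only [hΦ, D.cdf_sInf_types, rivalPotential_zero],
      mul_zero, mul_zero] at h1
    refine tendsto_of_tendsto_of_tendsto_of_le_of_le' tendsto_const_nhds h1
      (Eventually.of_forall hb0) ?_
    filter_upwards [D.eventually_mem_types] with x hx
    have h2 := bidIntegral_sub_le hc hm (D.pos_of_mem_types hx).le
    rw [bidIntegral_of_nonpos h0 le_rfl, h0 0 le_rfl, sub_zero, sub_zero] at h2
    exact mul_le_mul_of_nonneg_left h2 hK.le
  · have hx0 := D.pos_of_mem_types hx
    have hpos : 0 < rivalRate n (D.cdf x) * D.density x := mul_pos (rivalRate_pos hn _) hx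
    have hstrict := hasStrictDerivAt_of_hasDerivAt_of_continuousAt
      (f := fun x => B / k * bidIntegral Φ x)
      (f' := fun x => B / k * x * (rivalRate n (D.cdf x) * D.density x)) (x := x)
      (by filter_upwards [D.isOpen_types.mem_nhds hx] with z hz using hderiv z hz)
      ((continuous_const.mul continuous_id).continuousAt.mul
        (((continuous_rivalRate hn).comp D.continuous_cdf).continuousAt.mul
          (D.continuousOn_density.continuousAt (D.isOpen_types.mem_nhds hx))))
    have hb' : B / k * x * (rivalRate n (D.cdf x) * D.density x) ≠ 0 := by positivity
    -- The effort function has a continuous positive derivative, hence a local inverse. The winning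
    -- probability is the odds composed with this inverse and has slope `k / (B * x)`.
    have hW := hasDerivAt_of_comp_right hstrict hb'
      (W := fun e => rankProb D n 2 (fun x => B / k * bidIntegral Φ x) i x e 1)
      (hasDerivAt_oddsBelow_two (i := i) hn hx) (by
        filter_upwards [D.isOpen_types.mem_nhds hx] with z hz
        exact rankProb_apply le_rfl hx hbm hbs hz)
    have h1 := (hW.const_mul B).sub
      (((hasDerivAt_id (B / k * bidIntegral Φ x)).const_mul k).div_const x)
    refine (h1.congr_deriv ?_).congr_of_eventuallyEq (Eventually.of_forall fun e => ?_)
    · have hr := (rivalRate_pos hn (D.cdf x)).ne'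
      have hf : D.density x ≠ 0 := ne_of_gt hx
      field_simp
      ring
    · exact expectedUtility_winnerTakeAll two_pos _ _ _

end existence

/-! ### Logarithmic size of the potential. -/

section bounds

theorem pow_bounds_one_sub_inv {n : ℕ} (hn : 2 ≤ n) :
    3 / 4 ≤ (1 - 1 / (4 * (n : ℝ))) ^ (n - 1) ∧ (1 - 1 / (4 * (n : ℝ))) ^ n ≤ 4 / 5 := by
  have h2 : (2 : ℝ) ≤ n := by exact_mod_cast hn
  have ht : 1 / (4 * (n : ℝ)) ≤ 1 := by
    rw [div_le_one (by linarith)]; linarith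
  have ht0 : 0 < 1 / (4 * (n : ℝ)) := by positivity
  have hnt : (n : ℝ) * (1 / (4 * n)) = 1 / 4 := by field_simp
  constructor
  · have := one_add_mul_le_pow (a := -(1 / (4 * (n : ℝ)))) (by linarith) (n - 1)
    rw [Nat.cast_sub (by omega), Nat.cast_one] at this
    have e : (1 : ℝ) + -(1 / (4 * (n : ℝ))) = 1 - 1 / (4 * (n : ℝ)) := by ring
    rw [e] at this
    linarith
  · have h3 := one_add_mul_le_pow (a := 1 / (4 * (n : ℝ))) (by linarith) n
    have h4 : (1 - 1 / (4 * (n : ℝ))) ^ n * (1 + 1 / (4 * (n : ℝ))) ^ n ≤ 1 := by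
      rw [← mul_pow]
      refine pow_le_one₀ (mul_nonneg (by linarith) (by linarith)) ?_
      nlinarith
    have h5 : 0 ≤ (1 - 1 / (4 * (n : ℝ))) ^ n := pow_nonneg (by linarith) n
    nlinarith

/-- The denominators `(n - 1) (1 - s) + s` and `(n - 1) (1 - s) + 1` differ by a factor of at most
`2` on `[0, 1]`. The second one integrates to a logarithm uniformly in `n`, while the exact
antiderivative of the first degenerates at `n = 2`. -/
theorem rivalPotential_sub_bounds {n : ℕ} (hn : 2 ≤ n) {u w : ℝ} (hu : 0 ≤ u) (huw : u < w)
    (hw : w ≤ 1) :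
    Real.log ((n - 1) * (1 - u) + 1) - Real.log ((n - 1) * (1 - w) + 1) ≤
        rivalPotential n w - rivalPotential n u ∧
      rivalPotential n w - rivalPotential n u ≤
        2 * (Real.log ((n - 1) * (1 - u) + 1) - Real.log ((n - 1) * (1 - w) + 1)) := by
  have h2 : (2 : ℝ) ≤ n := by exact_mod_cast hn
  have hpos : ∀ s ≤ (1 : ℝ), 0 < ((n : ℝ) - 1) * (1 - s) + 1 := fun s hs => by nlinarith
  have hd : ∀ s ≤ (1 : ℝ), HasDerivAt (fun s => Real.log (((n : ℝ) - 1) * (1 - s) + 1))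
      (-((n : ℝ) - 1) / ((n - 1) * (1 - s) + 1)) s := fun s hs => by
    refine (((((hasDerivAt_id s).const_sub 1).const_mul ((n : ℝ) - 1)).add_const 1).log
      (hpos s hs).ne').congr_deriv ?_
    simp
  obtain ⟨c, hc, heq⟩ := exists_ratio_hasDerivAt_eq_ratio_slope (rivalPotential n) _ huw
    (fun s _ => (hasDerivAt_rivalPotential hn s).continuousAt.continuousWithinAt)
    (fun s _ => hasDerivAt_rivalPotential hn s) _ _
    (fun s hs => (hd s (hs.2.trans hw)).continuousAt.continuousWithinAt)
    (fun s hs => hd s (hs.2.le.trans hw))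
  have hc1 : c ≤ 1 := hc.2.le.trans hw
  have hc0 : 0 ≤ c := hu.trans hc.1.le
  rw [rivalRate_of_le_one n hc1] at heq
  have hp := hpos c hc1
  have hq : 0 < ((n : ℝ) - 1) * (1 - c) + c := by nlinarith
  have hN : (0 : ℝ) < n - 1 := by linarith
  have hmono : Real.log ((n - 1) * (1 - w) + 1) ≤ Real.log ((n - 1) * (1 - u) + 1) :=
    Real.log_le_log (hpos w hw) (by nlinarith)
  set A := Real.log ((n - 1) * (1 - u) + 1)
  set A' := Real.log ((n - 1) * (1 - w) + 1)
  have key : (rivalPotential n w - rivalPotential n u) * (((n : ℝ) - 1) * (1 - c) + c) =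
      (A - A') * (((n : ℝ) - 1) * (1 - c) + 1) := by
    field_simp at heq
    linarith
  constructor
  · refine le_of_mul_le_mul_right ?_ hq
    rw [key]
    exact mul_le_mul_of_nonneg_left (by linarith) (by linarith)
  · refine le_of_mul_le_mul_right ?_ hq
    rw [key]
    nlinarith [mul_nonneg (sub_nonneg.2 hmono)
      (show 0 ≤ ((n : ℝ) - 1) * (1 - c) + 2 * c - 1 by nlinarith)]

theorem rivalPotential_one_le {n : ℕ} (hn : 2 ≤ n) : rivalPotential n 1 ≤ 2 * Real.log n := by
  have := (rivalPotential_sub_bounds hn le_rfl one_pos le_rfl).2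
  rw [rivalPotential_zero] at this
  simpa using this

theorem log_div_four_le_rivalPotential_sub {n : ℕ} (hn : 2 ≤ n) :
    Real.log n / 4 ≤ rivalPotential n (1 - 1 / (4 * n)) - rivalPotential n (1 / 2) := by
  have h2 : (2 : ℝ) ≤ n := by exact_mod_cast hn
  have h8 : 1 / (4 * (n : ℝ)) ≤ 1 / 8 := one_div_le_one_div_of_le (by norm_num) (by linarith)
  have h0 : 0 < 1 / (4 * (n : ℝ)) := by positivity
  refine le_trans ?_ (rivalPotential_sub_bounds hn (by norm_num : (0 : ℝ) ≤ 1 / 2)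
    (by linarith : 1 / 2 < 1 - 1 / (4 * (n : ℝ))) (by linarith)).1
  have hnt : (n : ℝ) * (1 / (4 * n)) = 1 / 4 := by field_simp
  have h1 : ((n : ℝ) - 1) * (1 - (1 - 1 / (4 * n))) + 1 ≤ 5 / 4 := by linarith
  have h1' : 0 < ((n : ℝ) - 1) * (1 - (1 - 1 / (4 * n))) + 1 := by linarith
  -- The difference of logarithms is at least `log (2 (n + 1) / 5)`. The fourth power suffices
  -- already at `n = 2`, where `(6 / 5) ^ 4 > 2`.
  have h3 : (n : ℝ) ≤ (2 * (n + 1) / 5) ^ 4 := by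
    rcases hn.eq_or_lt with rfl | h
    · norm_num
    · have h3 : (3 : ℝ) ≤ n := by exact_mod_cast h
      have : ((3 + 1) : ℝ) ^ 3 ≤ (n + 1) ^ 3 := by gcongr
      nlinarith
  have h4 := Real.log_le_log (by linarith) h3
  rw [Real.log_pow] at h4
  have h5 := Real.log_le_log h1' h1
  have h6 : Real.log (2 * ((n : ℝ) + 1) / 5) =
      Real.log (((n : ℝ) - 1) * (1 - 1 / 2) + 1) - Real.log (5 / 4) := by
    rw [← Real.log_div (by nlinarith) (by norm_num)]
    congr 1
    ring
  push_cast at h4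
  linarith

end bounds

/-! ### Comparison of the two contests. -/

section comparison

variable {D : AbilityDistribution} {n m : ℕ} {b Φ : ℝ → ℝ} {K : ℝ}

theorem HasBidIncrements.le_mul (hK : 0 < K) (h : HasBidIncrements D K Φ b)
    (hΦ : ∀ x, 0 ≤ Φ x) (hb : Tendsto b (𝓝[>] (sInf D.types)) (𝓝 0)) {y : ℝ}
    (hy : y ∈ D.types) : b y ≤ K * y * Φ y := by
  have hy0 := D.pos_of_mem_types hy
  have h1 : Tendsto (fun x => b y - b x) (𝓝[>] (sInf D.types)) (𝓝 (b y - 0)) :=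
    hb.const_sub (b y)
  rw [sub_zero] at h1
  refine le_of_tendsto h1 ?_
  have hlt : sInf D.types < y := by
    obtain ⟨z, hz, hzy⟩ := D.exists_lt_mem_types hy
    exact (csInf_le ⟨0, fun _ hz => (D.pos_of_mem_types hz).le⟩ hz).trans_lt hzy
  filter_upwards [D.eventually_mem_types, Ioo_mem_nhdsGT hlt] with x hx hxy
  refine (h x hx y hy hxy.2.le).2.trans
    (mul_le_mul_of_nonneg_left (by linarith [hΦ x]) (by positivity))

theorem HasBidIncrements.maxEffort_bounds (hn : 2 ≤ n) (hm : 0 < m) (hK : 0 < K)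
    (h : HasBidIncrements D K Φ b)
    (hbm : Monotone b) (hb : ∀ x, 0 ≤ b x) (hle : ∀ x ∈ D.types, b x ≤ K * x * Φ x)
    {M V x y : ℝ} (hM : ∀ x, Φ x ≤ M) (hM0 : 0 ≤ M) (hV : ∀ x ∈ D.types, x ≤ V)
    (hx : x ∈ D.types) (hx2 : D.cdf x = 1 / 2) (hy : y ∈ D.types)
    (hyn : D.cdf y = 1 - 1 / (4 * n)) :
    K * x * (Φ y - Φ x) / 5 ≤ maxEffort D n m b ∧ maxEffort D n m b ≤ K * V * M := by
  have h2 : (2 : ℝ) ≤ n := by exact_mod_cast hn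
  have hV0 : 0 ≤ V := (D.pos_of_mem_types hx).le.trans (hV x hx)
  have hU : ∀ z ∈ D.types, b z ≤ K * V * M := fun z hz => (hle z hz).trans <| by
    have hz0 := (D.pos_of_mem_types hz).le
    calc K * z * Φ z ≤ K * z * M := mul_le_mul_of_nonneg_left (hM z) (by positivity)
      _ ≤ K * V * M := by
        have := hV z hz
        gcongr
  -- The factor `1 / 5` of the lower bound comes from `F(y) ^ n ≤ 4 / 5`: some ability exceeds `y`
  -- with at least this probability.
  have hU0 : 0 ≤ K * V * M := by positivity
  refine ⟨?_, maxEffort_le hb hU0 hU⟩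
  refine le_trans ?_ (le_maxEffort hm hbm hb hU0 hU y)
  have h8 : 1 / (4 * (n : ℝ)) ≤ 1 / 8 := one_div_le_one_div_of_le (by norm_num) (by linarith)
  have hxy : x ≤ y := by
    refine ((D.cdf_lt_cdf_iff hy).1 ?_).le
    rw [hx2, hyn]; linarith
  have h3 := (h x hx y hy hxy).1
  have h4 := (pow_bounds_one_sub_inv hn).2
  rw [← hyn] at h4
  have h5 := mul_le_mul_of_nonneg_left (show 1 / 5 ≤ 1 - D.cdf y ^ n by linarith) (hb y)
  linarith [hb x]

end comparison

theorem mainTheorem8 (L' L : ℝ) (hL' : 0 < L') :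
    ∃ c C : ℝ, 0 < c ∧ 0 < C ∧
      ∀ D : AbilityDistribution,
        (∀ q ∈ Set.Ioo (0 : ℝ) 1, L' ≤ |deriv D.quantile q| ∧ |deriv D.quantile q| ≤ L) →
        ∀ k B : ℝ, 0 < k → 0 < B → ∀ n : ℕ, 2 ≤ n →
          (∃ b : ℝ → ℝ, IsSBNE D n n (winnerTakeAll B) (linearCost k) b) ∧
          (∃ b : ℝ → ℝ, IsFirstOrderSBNE D n 2 (winnerTakeAll B) (linearCost k) b) ∧
          ∀ b₂ bₙ : ℝ → ℝ,
            (IsSBNE D n 2 (winnerTakeAll B) (linearCost k) b₂ ∨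
              IsFirstOrderSBNE D n 2 (winnerTakeAll B) (linearCost k) b₂) →
            IsSBNE D n n (winnerTakeAll B) (linearCost k) bₙ →
              0 < maxEffort D n n bₙ ∧
              c * Real.log n ≤ maxEffort D n 2 b₂ / maxEffort D n n bₙ ∧
              maxEffort D n 2 b₂ / maxEffort D n n bₙ ≤ C * Real.log n := by
  have hR : 0 < 1 + |L| / L' := by positivity
  -- With `x` the median, and in units of `B * x / k`, the expected maximum lies in `[1 / 20, R]`
  -- for `n` contestants and in `[log n / 20, 2 R log n]` for two.
  refine ⟨1 / (20 * (1 + |L| / L')), 40 * (1 + |L| / L'), by positivity, by positivity, ?_⟩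
  intro D hD k B hk hB n hn
  set R := 1 + |L| / L'
  have h2 : (2 : ℝ) ≤ n := by exact_mod_cast hn
  have hK : 0 < B / k := div_pos hB hk
  obtain ⟨x, hx, hx2⟩ := D.exists_cdf_eq (u := 1 / 2) (by norm_num) (by norm_num)
  have h8 : 1 / (4 * (n : ℝ)) ≤ 1 / 8 := one_div_le_one_div_of_le (by norm_num) (by linarith)
  have h80 : 0 < 1 / (4 * (n : ℝ)) := by positivity
  obtain ⟨y, hy, hyn⟩ := D.exists_cdf_eq (u := 1 - 1 / (4 * n)) (by linarith) (by linarith)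
  have hx0 := D.pos_of_mem_types hx
  have hV : ∀ z ∈ D.types, z ≤ R * x := fun z hz => D.le_mul_median hL' hD hx hx2 hz
  refine ⟨exists_isSBNE hk hB hn hV, exists_isFirstOrderSBNE hk hB hn, ?_⟩
  intro b₂ bₙ hb₂ hbₙ
  have hlog : 0 < Real.log n := Real.log_pos (by linarith)
  have hkx : 0 < B / k * x := by positivity
  let i : Fin n := ⟨0, by omega⟩
  obtain ⟨hnl, hnu⟩ := (hbₙ.hasBidIncrements_self hk hB hn).maxEffort_bounds (m := n) hn (by omega) hK
    hbₙ.monotone hbₙ.nonneg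
    (fun z hz => (hbₙ.le_oddsBelow hk hB hn hn i hz).trans_eq (by rw [oddsBelow_self]))
    (M := 1) (fun z => pow_le_one₀ (D.cdf_nonneg z) (D.cdf_le_one z)) zero_le_one hV hx hx2 hy hyn
  have hcond : Monotone b₂ ∧ (∀ z, 0 ≤ b₂ z) ∧ Tendsto b₂ (𝓝[>] (sInf D.types)) (𝓝 0) ∧
      ∀ z ∈ D.types, HasDerivAt b₂ (B / k * z * rivalRate n (D.cdf z) * D.density z) z := by
    rcases hb₂ with h | h
    · exact ⟨h.monotone, h.nonneg, h.tendsto_bottom_two hk hB hn,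
        fun z hz => h.hasDerivAt_two hk hB hn hz⟩
    · exact ⟨h.monotone, h.nonneg, h.tendsto_bottom, fun z hz => h.hasDerivAt_two hk hB hn hz⟩
  obtain ⟨hmono, hnonneg, hbot, hder⟩ := hcond
  have hinc := hasBidIncrements_of_hasDerivAt hn hK hder
  have hpot := (strictMono_rivalPotential hn).monotone
  obtain ⟨h2l, h2u⟩ := hinc.maxEffort_bounds hn two_pos hK hmono hnonneg
    (fun z hz => hinc.le_mul hK
      (fun t => (rivalPotential_zero n).symm.trans_le (hpot (D.cdf_nonneg t))) hbot hz)
    (fun z => (hpot (D.cdf_le_one z)).trans (rivalPotential_one_le hn)) (by positivity)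
    hV hx hx2 hy hyn
  have hpow : D.cdf x ^ (n - 1) ≤ 1 / 2 := by
    rw [hx2]
    exact pow_le_of_le_one (by norm_num) (by norm_num) (by omega)
  have hpow' := (pow_bounds_one_sub_inv hn).1
  rw [← hyn] at hpow'
  have hnl' : B / k * x / 20 ≤ maxEffort D n n bₙ := by
    have := mul_le_mul_of_nonneg_left
      (show 1 / 4 ≤ D.cdf y ^ (n - 1) - D.cdf x ^ (n - 1) by linarith) hkx.le
    linarith
  have h2l' : B / k * x * Real.log n / 20 ≤ maxEffort D n 2 b₂ := by
    have h3 := log_div_four_le_rivalPotential_sub hn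
    rw [← hyn, ← hx2] at h3
    have := mul_le_mul_of_nonneg_left h3 hkx.le
    linarith
  have hpos : 0 < maxEffort D n n bₙ := lt_of_lt_of_le (by positivity) hnl'
  refine ⟨hpos, ?_, ?_⟩
  · rw [le_div_iff₀ hpos]
    calc 1 / (20 * R) * Real.log n * maxEffort D n n bₙ
        ≤ 1 / (20 * R) * Real.log n * (B / k * (R * x) * 1) :=
          mul_le_mul_of_nonneg_left hnu (by positivity)
      _ = B / k * x * Real.log n / 20 := by field_simp
      _ ≤ _ := h2l'
  · rw [div_le_iff₀ hpos]
    calc maxEffort D n 2 b₂ ≤ B / k * (R * x) * (2 * Real.log n) := h2u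
      _ = 40 * R * Real.log n * (B / k * x / 20) := by ring
      _ ≤ _ := mul_le_mul_of_nonneg_left hnl' (by positivity)
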